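/- Let $(\Lambda_f,\eta)$ and $(\Lambda_{\widetilde f},\widetilde\eta)$ be two admissible irrational polygonal gratings, as follows. The function $f:\mathbb{R}\to\mathbb{R}$ is Lipschitz, $2\pi$-periodic and piecewise linear with finitely many pieces in one period, $\Lambda_f=\{x\in\mathbb{R}^2:\ x_2=f(x_1)\}$ and $\Omega_f=\{x\in\mathbb{R}^2:\ x_2>f(x_1)\}$; the boundary parameter $\eta:\Lambda_f\to\mathbb{C}\cup\{\infty\}$ is $2\pi$-periodic in $x_1$ and on each piece of $\Lambda_f$ it is a constant in $\mathbb{C}$ or identically $\infty$. A corner point of $\Lambda_f$ is a point where two pieces of different slopes meet, and the angle between two pieces meeting at any corner point is $2\pi\alpha$ with $\alpha$ irrational. The same holds for $(\Lambda_{\widetilde f},\widetilde\eta)$. Let $\mathbf G$ be the unbounded connected component of $\Omega_f\cap\Omega_{\widetilde f}$. Fix $k>0$ and two distinct incident directions $\mathbf d_\ell=(\sin\theta_\ell,-\cos\theta_\ell)$ with $\theta_\ell\in(-\frac{\pi}{2},\frac{\pi}{2})$, $\ell=1,2$. For $\ell=1,2$ let $u(\cdot;k,\mathbf d_\ell)$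 be a total field for $(\Lambda_f,\eta)$, that is, a function $u\in C^2(\Omega_f)$ that is in $H^1$ on every bounded part of $\Omega_f$ and satisfies $$\Delta u+k^2u=0\ \text{ in }\Omega_f,\qquad \partial_\nu u+\eta u=0\ \text{ on }\Lambda_f,\qquad u(x_1+2\pi,x_2)=e^{2\pi i k\sin\theta_\ell}\,u(x_1,x_2),$$ where $\nu$ is the unit normal pointing into $\Omega_f$ and the boundary condition, which means $u=0$ where $\eta=\infty$, is understood in the usual variational sense, and $$u(x)=e^{ik\mathbf d_\ell\cdot x}+\sum_{n\in\mathbb{Z}}u_n\,e^{i(\alpha_nx_1+\beta_nx_2)}\quad\text{for } x_2>\max f$$ with some $u_n\in\mathbb{C}$ (the series converging absolutely), where $\alpha_n=n+k\sin\theta_\ell$, and $\beta_n=\sqrt{k^2-\alpha_n^2}$ if $|\alpha_n|\le k$, $\beta_n=i\sqrt{\alpha_n^2-k^2}$ if $|\alpha_n|>k$. Let $\widetilde u(\cdot;k,\mathbf d_\ell)$ be a total field for $(\Lambda_{\widetilde f},\widetilde\eta)$ in the same sense. Let $b>\max|f|$ and $b>\max|\widetilde f|$. If $$u((x_1,b);k,\mathbf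 d_\ell)=\widetilde u((x_1,b);k,\mathbf d_\ell)\qquad\text{for all } x_1\in[0,2\pi],\ \ell=1,2,$$ then no corner point of $\Lambda_f$ lies on $\partial\mathbf G\setminus\Lambda_{\widetilde f}$, and no corner point of $\Lambda_{\widetilde f}$ lies on $\partial\mathbf G\setminus\Lambda_f$. -/

import Mathlib

open MeasureTheory Filter

namespace DiffractionGrating

/-- The plane with its Euclidean structure; `x 0`, `x 1` are the coordinates `x₁`, `x₂`. -/
abbrev Plane : Type := EuclideanSpace ℝ (Fin 2)

/-- The curve `Λ_f = {x₂ = f(x₁)}`. -/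
def profileCurve (f : ℝ → ℝ) : Set Plane := {x | x 1 = f (x 0)}

/-- The domain `Ω_f = {x₂ > f(x₁)}` above the curve. -/
def upperDomain (f : ℝ → ℝ) : Set Plane := {x | f (x 0) < x 1}

/-- `(Λ_f, η)` is an admissible polygonal grating. The boundary parameter, which takes values in
`ℂ ∪ {∞}`, is given as a function of the abscissa: `η t` is its value at the point `(t, f t)`.
One period `[0, 2π]` is cut into finitely many intervals; over each of them `f` is affine and `η`
is a constant of `ℂ` or is identically `∞`. -/
structure IsAdmissible (f : ℝ → ℝ) (η : ℝ → OnePoint ℂ) : Prop where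
  lipschitz : ∃ K, LipschitzWith K f
  periodic : Function.Periodic f (2 * Real.pi)
  periodic_parameter : Function.Periodic η (2 * Real.pi)
  piecewise : ∃ (n : ℕ) (t : ℕ → ℝ), t 0 = 0 ∧ t n = 2 * Real.pi ∧ (∀ i < n, t i < t (i + 1)) ∧
    ∀ i < n, ∃ (m c : ℝ) (e : OnePoint ℂ), ∀ s ∈ Set.Ioo (t i) (t (i + 1)),
      f s = m * s + c ∧ η s = e

/-- At the abscissa `t`, a linear piece of slope `m₁` (on the left) and a linear piece of a
different slope `m₂` (on the right) of the graph of `f` meet. -/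
def HasCornerAt (f : ℝ → ℝ) (t m₁ m₂ : ℝ) : Prop :=
  m₁ ≠ m₂ ∧ (∀ᶠ s in nhdsWithin t (Set.Iio t), f s = f t + m₁ * (s - t)) ∧
    ∀ᶠ s in nhdsWithin t (Set.Ioi t), f s = f t + m₂ * (s - t)

/-- The set of corner points of `Λ_f`. -/
def cornerPoints (f : ℝ → ℝ) : Set Plane :=
  {p | p ∈ profileCurve f ∧ ∃ m₁ m₂ : ℝ, HasCornerAt f (p 0) m₁ m₂}

/-- The angle between the two pieces at a corner: the left piece leaves the corner in the direction
`(-1, -m₁)`, the right one in the direction `(1, m₂)`. Measuring it from the other side gives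
`2π` minus this value, which does not affect its rationality. -/
noncomputable def cornerAngle (m₁ m₂ : ℝ) : ℝ :=
  InnerProductGeometry.angle (!₂[-1, -m₁] : Plane) (!₂[1, m₂] : Plane)

/-- Every corner angle is of the form `α · 2π` with `α` irrational. -/
def AllCornersIrrational (f : ℝ → ℝ) : Prop :=
  ∀ t m₁ m₂ : ℝ, HasCornerAt f t m₁ m₂ → Irrational (cornerAngle m₁ m₂ / (2 * Real.pi))

/-- `G` is an unbounded connected component of `A`. -/
def IsUnboundedComponent (G A : Set Plane) : Prop :=
  (∃ x ∈ A, G = connectedComponentIn A x) ∧ ¬ Bornology.IsBounded G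

/-- The incident direction `d = (sin θ, -cos θ)`. -/
noncomputable def incidentDirection (θ : ℝ) : Plane := !₂[Real.sin θ, -Real.cos θ]

/-- The incident plane wave `exp(i k d · x)`. -/
noncomputable def incidentWave (k θ : ℝ) (x : Plane) : ℂ :=
  Complex.exp (Complex.I * k * (inner ℝ (incidentDirection θ) x : ℝ))

/-- `α_n(θ) = n + k sin θ`. -/
noncomputable def alphaMode (k θ : ℝ) (n : ℤ) : ℝ := n + k * Real.sin θ

open Classical in
/-- `β_n(θ)`, equal to `√(k² - α_n²)` if `|α_n| ≤ k` and to `i √(α_n² - k²)` otherwise. -/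
noncomputable def betaMode (k θ : ℝ) (n : ℤ) : ℂ :=
  if |alphaMode k θ n| ≤ k then (Real.sqrt (k ^ 2 - alphaMode k θ n ^ 2) : ℂ)
  else Complex.I * (Real.sqrt (alphaMode k θ n ^ 2 - k ^ 2) : ℂ)

/-- The Rayleigh mode `exp(i ξ_n(θ) · x)`, where `ξ_n = (α_n, β_n)`. -/
noncomputable def rayleighMode (k θ : ℝ) (n : ℤ) (x : Plane) : ℂ :=
  Complex.exp (Complex.I * (alphaMode k θ n * x 0 + betaMode k θ n * x 1))

/-- The partial derivative `∂_i v`. -/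
noncomputable def partialDeriv (i : Fin 2) (v : Plane → ℂ) (x : Plane) : ℂ :=
  fderiv ℝ v x (EuclideanSpace.single i 1)

/-- `w`, as a function of the abscissa, is the trace on `Λ_f` of the function `u` on `Ω_f`: the
functions `t ↦ u (t, f t + s)` converge to `w` in `L²_loc(ℝ)` as `s ↓ 0`. -/
def IsTrace (f : ℝ → ℝ) (u : Plane → ℂ) (w : ℝ → ℂ) : Prop :=
  ∀ R : ℝ, MemLp w 2 (volume.restrict (Set.Icc (-R) R)) ∧
    Tendsto (fun s : ℝ => eLpNorm (fun t : ℝ => u !₂[t, f t + s] - w t) 2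
      (volume.restrict (Set.Icc (-R) R))) (nhdsWithin 0 (Set.Ioi 0)) (nhds 0)

/-- The finite value of a boundary parameter; the value given to `∞` is never used, since test
functions vanish where the parameter is infinite. -/
noncomputable def finiteValue (e : OnePoint ℂ) : ℂ := e.elim 0 id

/-- The generalized impedance condition `∂_ν u + η u = 0` on `Λ_f`, in the usual variational
sense, for a function `u` with trace `w` that satisfies `Δu + k²u = 0` in `Ω_f`. The unit normal
`ν` is exterior to the grating, so it points into `Ω_f`. Where `η = ∞` the condition reads `u = 0`;
elsewhere it is the natural boundary condition of
`∫_{Ω_f} (∇u · ∇φ - k² u φ) dx = ∫_{Λ_f} η u φ ds` for test functions `φ` that vanish where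
`η = ∞`. The arc length element at `(t, f t)` is `√(1 + f'(t)²) dt`. -/
def SatisfiesBoundaryCondition (f : ℝ → ℝ) (η : ℝ → OnePoint ℂ) (k : ℝ) (u : Plane → ℂ)
    (w : ℝ → ℂ) : Prop :=
  (∀ᵐ t : ℝ, η t = OnePoint.infty → w t = 0) ∧
  ∀ φ : Plane → ℂ, ContDiff ℝ (⊤ : ℕ∞) φ → HasCompactSupport φ →
    (∀ᵐ t : ℝ, η t = OnePoint.infty → φ !₂[t, f t] = 0) →
    ∫ x in upperDomain f,
        ((∑ i : Fin 2, partialDeriv i u x * partialDeriv i φ x) - (k : ℂ) ^ 2 * u x * φ x) =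
      ∫ t : ℝ, finiteValue (η t) * w t * φ !₂[t, f t] * (Real.sqrt (1 + deriv f t ^ 2) : ℂ)

/-- `u` is a total field for the grating `(Λ_f, η)`, the wave number `k` and the incident plane
wave of angle `θ`. Only the values of `u` on `Ω_f` matter. -/
structure IsTotalField (f : ℝ → ℝ) (η : ℝ → OnePoint ℂ) (k θ : ℝ) (u : Plane → ℂ) : Prop where
  /-- `u` is a twice continuously differentiable solution of the Helmholtz equation in `Ω_f`. -/
  contDiffOn : ContDiffOn ℝ 2 u (upperDomain f)
  helmholtz : ∀ x ∈ upperDomain f, Laplacian.laplacian u x + (k : ℂ) ^ 2 * u x = 0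
  /-- `u` is in `H¹` on every bounded part of `Ω_f`, up to the boundary. -/
  memLp : ∀ R : ℝ, MemLp u 2 (volume.restrict (upperDomain f ∩ Metric.ball 0 R))
  memLp_fderiv : ∀ R : ℝ,
    MemLp (fderiv ℝ u) 2 (volume.restrict (upperDomain f ∩ Metric.ball 0 R))
  boundary : ∃ w : ℝ → ℂ, IsTrace f u w ∧ SatisfiesBoundaryCondition f η k u w
  quasiperiodic : ∀ x ∈ upperDomain f, u (x + !₂[2 * Real.pi, 0]) =
    Complex.exp (2 * Complex.I * (k * Real.sin θ : ℝ) * Real.pi) * u x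
  /-- The scattered field has a Rayleigh expansion above the grating. -/
  rayleigh : ∃ c : ℤ → ℂ, ∀ x : Plane, (∀ t : ℝ, f t < x 1) →
    HasSum (fun n : ℤ => c n * rayleighMode k θ n x) (u x - incidentWave k θ x)

end DiffractionGrating

/-!
The component `G` lies in `Ω₁ ∩ Ω₂`, where `Ω₁`, `Ω₂` are the domains above the two gratings. Let
`p` be a corner of `Λ₁` in the frontier of `G` and off `Λ₂`; then `p` is an interior point of `Ω₂`.

*The fields agree.* On a horizontal line the coefficients of a Rayleigh series are Fourier
coefficients, so the data on `x₂ = b` determine the total fields above that line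
(`IsTotalField.eq_above`). As `Ω₁ ∩ Ω₂`, the domain above the graph of the larger function, is
connected, unique continuation shows that `u₁` and `u₂` agree there
(`IsTotalField.eq_of_measurement`). Hence near `p` the field `u₂` is a smooth extension of `u₁`
across `Λ₁`. On both linear pieces that meet at `p` the variational boundary condition and the trace
condition therefore become pointwise conditions on `u₂`
(`SatisfiesBoundaryCondition.pointwise`): a Dirichlet or an impedance condition.

*A combination that vanishes at the corner vanishes identically.* For two incident directions there
is a nontrivial combination `v` of the two fields `u₂` with `v p = 0`. Suppose that the expansion of
`v` at `p` starts with `rᵐ (a e^{imφ} + b e^{-imφ})`, where `m ≥ 1`. Since the impedance term is of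
higher order than the normal derivative, this leading part satisfies a Dirichlet or a Neumann
condition on each of the two rays. It follows that `a² e^{4imφ} = b²` for both polar angles `φ`,
which is impossible, unless `a = b = 0`, for rays that meet at an angle irrational relative to `π`
(`SolvesHelmholtz.eq_zero_near_corner`). So `v = 0` near `p`, hence in `Ω₂`; but the total fields of
distinct incident directions are linearly independent, since the first incident wave occurs in only
one of them (`IsTotalField.coeff_eq_zero`).

*Local expansions without elliptic regularity.* The fields are only assumed to be `C²`. The angular
Fourier coefficients of a `C²` solution about a point satisfy Bessel's equation and stay bounded at
the centre. The Wronskian identifies them with multiples of the regular solutions `radialMode`, which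
are given by explicit power series. The resulting convergent expansion
(`exists_angular_expansion`) provides both unique continuation
(`SolvesHelmholtz.eq_zero_of_isPreconnected`) and the leading behaviour used at the corner.
-/

namespace DiffractionGrating

/-! ### Regular solutions of the Bessel equation -/

/-- The coefficient `n! / (m! (n + m)!)` of `x ^ m` in the entire function `₀F₁(n + 1; x)`. -/
noncomputable def besselCoeff (n m : ℕ) : ℝ := n.factorial / (m.factorial * (n + m).factorial)

/-- The entire function `₀F₁(n + 1; x) = ∑ₘ n! xᵐ / (m! (n + m)!)`. It is `1` at the origin, and
`rⁿ ₀F₁(n + 1; -(k r / 2)²)` is a multiple of the Bessel function `Jₙ(k r)`. -/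
noncomputable def besselSeries (n : ℕ) (x : ℝ) : ℝ := ∑' m : ℕ, besselCoeff n m * x ^ m

lemma besselCoeff_nonneg (n m : ℕ) : 0 ≤ besselCoeff n m := by
  unfold besselCoeff; positivity

lemma besselCoeff_zero (n : ℕ) : besselCoeff n 0 = 1 := by
  simp [besselCoeff, Nat.factorial_ne_zero]

lemma besselCoeff_le (n m : ℕ) : besselCoeff n m ≤ 1 / m.factorial := by
  unfold besselCoeff
  rw [div_le_div_iff₀ (by positivity) (by positivity), one_mul, mul_comm]
  gcongr
  omega

lemma succ_mul_besselCoeff (n m : ℕ) :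
    ((m : ℝ) + 1) * besselCoeff n (m + 1) = besselCoeff (n + 1) m / (n + 1) := by
  unfold besselCoeff
  rw [show n + (m + 1) = n + m + 1 by ring, show n + 1 + m = n + m + 1 by ring,
    Nat.factorial_succ n, Nat.factorial_succ m]
  have := Nat.factorial_pos (n + m + 1)
  push_cast
  field_simp

lemma besselCoeff_recurrence (n m : ℕ) :
    besselCoeff n (m + 1) =
      besselCoeff (n + 1) (m + 1) + besselCoeff (n + 2) m / ((n + 1) * (n + 2)) := by
  unfold besselCoeff
  rw [show n + (m + 1) = n + m + 1 by ring, show n + 1 + (m + 1) = n + m + 1 + 1 by ring,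
    show n + 2 + m = n + m + 1 + 1 by ring,
    Nat.factorial_succ (n + m + 1), Nat.factorial_succ (n + 1), Nat.factorial_succ n,
    Nat.factorial_succ m]
  push_cast
  field_simp
  ring

lemma summable_besselCoeff (n : ℕ) (x : ℝ) : Summable fun m : ℕ => besselCoeff n m * x ^ m := by
  refine Summable.of_norm_bounded (Real.summable_pow_div_factorial |x|) fun m => ?_
  rw [norm_mul, norm_pow, Real.norm_eq_abs, Real.norm_eq_abs, abs_of_nonneg (besselCoeff_nonneg n m),
    div_eq_mul_one_div, mul_comm]
  gcongr
  exact besselCoeff_le n m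

lemma besselSeries_eq (n : ℕ) (x : ℝ) :
    besselSeries n x = 1 + ∑' m : ℕ, besselCoeff n (m + 1) * x ^ (m + 1) := by
  rw [besselSeries, (summable_besselCoeff n x).tsum_eq_zero_add, besselCoeff_zero]
  simp

lemma besselSeries_recurrence (n : ℕ) (x : ℝ) :
    besselSeries n x =
      besselSeries (n + 1) x + x / ((n + 1) * (n + 2)) * besselSeries (n + 2) x := by
  rw [besselSeries_eq n, besselSeries_eq (n + 1), besselSeries, ← tsum_mul_left, add_assoc,
    ← Summable.tsum_add ((summable_nat_add_iff 1).2 (summable_besselCoeff (n + 1) x))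
      ((summable_besselCoeff (n + 2) x).mul_left _)]
  congr 2
  ext m
  rw [besselCoeff_recurrence]
  ring

lemma hasDerivAt_besselSeries (n : ℕ) (x : ℝ) :
    HasDerivAt (besselSeries n) (besselSeries (n + 1) x / (n + 1)) x := by
  set R : ℝ := |x| + 1
  have hx : x ∈ Metric.ball (0 : ℝ) R := by simp [R]
  have hu : Summable fun m : ℕ => (m : ℝ) * besselCoeff n m * R ^ (m - 1) := by
    rw [← summable_nat_add_iff 1]
    refine ((summable_besselCoeff (n + 1) R).div_const ((n : ℝ) + 1)).congr fun m => ?_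
    push_cast
    rw [succ_mul_besselCoeff]
    ring
  have h := hasDerivAt_tsum_of_isPreconnected (g := fun m y => besselCoeff n m * y ^ m)
    (g' := fun m y => besselCoeff n m * (m * y ^ (m - 1))) hu Metric.isOpen_ball
    (convex_ball (0 : ℝ) R).isPreconnected
    (fun m y _ => (hasDerivAt_pow m y).const_mul _) (fun m y hy => ?_) hx
    (summable_besselCoeff n x) hx
  · refine h.congr_deriv ?_
    have hs : Summable fun m : ℕ => besselCoeff n m * (m * x ^ (m - 1)) := by
      refine Summable.of_norm_bounded hu fun m => ?_
      rw [norm_mul, norm_mul, norm_pow, Real.norm_eq_abs, Real.norm_eq_abs, Real.norm_eq_abs,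
        abs_of_nonneg (besselCoeff_nonneg n m), Nat.abs_cast, ← mul_assoc, mul_comm (besselCoeff n m)]
      have := besselCoeff_nonneg n m
      gcongr
      simp [R]
    rw [hs.tsum_eq_zero_add, besselSeries, ← tsum_div_const]
    simp only [Nat.cast_zero, zero_mul, mul_zero, zero_add]
    refine tsum_congr fun m => ?_
    have := succ_mul_besselCoeff n m
    push_cast
    linear_combination x ^ m * this
  · rw [norm_mul, norm_mul, norm_pow, Real.norm_eq_abs, Real.norm_eq_abs, Real.norm_eq_abs,
      abs_of_nonneg (besselCoeff_nonneg n m), Nat.abs_cast, ← mul_assoc, mul_comm (besselCoeff n m)]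
    have := besselCoeff_nonneg n m
    have hy' : |y| ≤ R := by
      rw [mem_ball_zero_iff, Real.norm_eq_abs] at hy
      exact hy.le
    gcongr

lemma abs_besselSeries_sub_one_le (n : ℕ) {x : ℝ} (hx : |x| ≤ 1 / 4) :
    |besselSeries n x - 1| ≤ 1 / 2 := by
  have hg : Summable fun m : ℕ => (1 / 4 : ℝ) ^ m :=
    summable_geometric_of_lt_one (by norm_num) (by norm_num)
  have hb : ∀ m : ℕ, ‖besselCoeff n (m + 1) * x ^ (m + 1)‖ ≤ 1 / 4 * (1 / 4 : ℝ) ^ m := fun m => by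
    rw [norm_mul, norm_pow, Real.norm_eq_abs, Real.norm_eq_abs,
      abs_of_nonneg (besselCoeff_nonneg n _), ← pow_succ']
    calc besselCoeff n (m + 1) * |x| ^ (m + 1) ≤ 1 * (1 / 4) ^ (m + 1) := by
          gcongr
          refine (besselCoeff_le n _).trans ?_
          rw [div_le_one (by positivity)]
          exact_mod_cast Nat.factorial_pos (m + 1)
      _ = _ := one_mul _
  rw [besselSeries_eq, add_sub_cancel_left, ← Real.norm_eq_abs]
  refine (tsum_of_norm_bounded (hg.mul_left _).hasSum hb).trans ?_
  rw [tsum_mul_left, tsum_geometric_of_lt_one (by norm_num) (by norm_num)]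
  norm_num

/-- The solution `rⁿ ₀F₁(n + 1; -(k r / 2)²)` of Bessel's equation of order `n` that is regular
at the origin, normalized so that its leading term is `rⁿ`. -/
noncomputable def radialMode (k : ℝ) (n : ℕ) (r : ℝ) : ℝ :=
  r ^ n * besselSeries n (-(k ^ 2 / 4) * r ^ 2)

/-- The derivative of `radialMode k n`. -/
noncomputable def radialModeDeriv (k : ℝ) (n : ℕ) (r : ℝ) : ℝ :=
  n * r ^ (n - 1) * besselSeries n (-(k ^ 2 / 4) * r ^ 2) -
    k ^ 2 / (2 * (n + 1)) * r ^ (n + 1) * besselSeries (n + 1) (-(k ^ 2 / 4) * r ^ 2)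

lemma hasDerivAt_besselSeries_comp (k : ℝ) (n : ℕ) (r : ℝ) :
    HasDerivAt (fun r : ℝ => besselSeries n (-(k ^ 2 / 4) * r ^ 2))
      (-(k ^ 2 * r / (2 * (n + 1))) * besselSeries (n + 1) (-(k ^ 2 / 4) * r ^ 2)) r := by
  have h := (hasDerivAt_besselSeries n (-(k ^ 2 / 4) * r ^ 2)).comp r
    ((hasDerivAt_pow 2 r).const_mul (-(k ^ 2 / 4)))
  refine h.congr_deriv ?_
  field_simp
  ring

lemma hasDerivAt_radialMode (k : ℝ) (n : ℕ) (r : ℝ) :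
    HasDerivAt (radialMode k n) (radialModeDeriv k n r) r := by
  refine ((hasDerivAt_pow n r).mul (hasDerivAt_besselSeries_comp k n r)).congr_deriv ?_
  rw [radialModeDeriv]
  field_simp
  ring

lemma exists_hasDerivAt_radialModeDeriv (k : ℝ) (n : ℕ) (r : ℝ) :
    ∃ D : ℝ, HasDerivAt (radialModeDeriv k n) D r ∧
      r ^ 2 * D + r * radialModeDeriv k n r + (k ^ 2 * r ^ 2 - n ^ 2) * radialMode k n r = 0 := by
  refine ⟨_, ((((hasDerivAt_pow (n - 1) r).const_mul (n : ℝ)).mul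
    (hasDerivAt_besselSeries_comp k n r)).sub
    (((hasDerivAt_pow (n + 1) r).const_mul (k ^ 2 / (2 * ((n : ℝ) + 1)))).mul
    (hasDerivAt_besselSeries_comp k (n + 1) r))), ?_⟩
  have h1 : (n : ℝ) * r ^ (n - 1) * r = n * r ^ n := by
    rcases n with _ | n
    · simp
    · simp [pow_succ, mul_assoc]
  have h2 : (n : ℝ) * (((n - 1 : ℕ) : ℝ) * r ^ (n - 1 - 1)) * r ^ 2 = n * (n - 1) * r ^ n := by
    rcases n with _ | _ | n
    · simp
    · simp
    · push_cast
      ring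
  have h3 := besselSeries_recurrence n (-(k ^ 2 / 4) * r ^ 2)
  simp only [radialMode, radialModeDeriv, Nat.add_sub_cancel]
  push_cast
  set A := besselSeries n (-(k ^ 2 / 4) * r ^ 2)
  set B := besselSeries (n + 1) (-(k ^ 2 / 4) * r ^ 2)
  set C := besselSeries (n + 2) (-(k ^ 2 / 4) * r ^ 2)
  have h4 : (-(k ^ 2 / 4) * r ^ 2) / ((n + 1) * (n + 2)) * C = A - B := by rw [h3]; ring
  have h5 : (k ^ 2 / (2 * ((n : ℝ) + 1)) * (2 * (n + 1))) = k ^ 2 := by field_simp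
  have h6 : (k ^ 2 / (2 * ((n : ℝ) + 1)) * (r ^ (n + 1) * (k ^ 2 * r / (2 * (n + 2)) * C)) * r ^ 2)
      = - k ^ 2 * r ^ 2 * r ^ n * (A - B) := by
    rw [← h4]
    field_simp
    ring
  have h7 : (k ^ 2 * r / (2 * ((n : ℝ) + 1))) = k ^ 2 / (2 * ((n : ℝ) + 1)) * r := by ring
  rw [h7, show (n : ℝ) + 1 + 1 = n + 2 by ring]
  set q := k ^ 2 / (2 * ((n : ℝ) + 1))
  simp only [pow_succ r n] at *
  linear_combination A * h2 - q * r ^ 2 * B * h1 + A * h1 + h6 - r ^ 2 * r ^ n * B * h5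

lemma radialMode_bounds (k : ℝ) (n : ℕ) {r : ℝ} (hr : 0 ≤ r) (hkr : |k| * r ≤ 1) :
    r ^ n / 2 ≤ radialMode k n r ∧ radialMode k n r ≤ 3 / 2 * r ^ n := by
  have hx : |-(k ^ 2 / 4) * r ^ 2| ≤ 1 / 4 := by
    have : (|k| * r) ^ 2 ≤ 1 := pow_le_one₀ (by positivity) hkr
    rw [mul_pow, sq_abs] at this
    rw [abs_le]
    constructor <;> nlinarith [mul_nonneg (sq_nonneg k) (sq_nonneg r)]
  have h := abs_le.1 (abs_besselSeries_sub_one_le n hx)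
  have hp : 0 ≤ r ^ n := by positivity
  unfold radialMode
  constructor <;> nlinarith [h.1, h.2]

/-! ### Polar coordinates -/

/-- The unit vector of polar angle `φ`. -/
noncomputable def polarDir (φ : ℝ) : Plane := !₂[Real.cos φ, Real.sin φ]

/-- The unit vector `polarDir φ` turned counterclockwise by a right angle. -/
noncomputable def polarNormal (φ : ℝ) : Plane := !₂[-Real.sin φ, Real.cos φ]

/-- The `i`-th vector of the standard basis of the plane. -/
noncomputable abbrev stdVec (i : Fin 2) : Plane := EuclideanSpace.single i 1

lemma polarDir_eq (φ : ℝ) : polarDir φ = Real.cos φ • stdVec 0 + Real.sin φ • stdVec 1 := by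
  ext i; fin_cases i <;> simp [polarDir]

lemma polarNormal_eq (φ : ℝ) :
    polarNormal φ = (-Real.sin φ) • stdVec 0 + Real.cos φ • stdVec 1 := by
  ext i; fin_cases i <;> simp [polarNormal]

lemma norm_polarDir (φ : ℝ) : ‖polarDir φ‖ = 1 := by
  simp [EuclideanSpace.norm_eq, polarDir]

lemma hasDerivAt_polarDir (φ : ℝ) : HasDerivAt polarDir (polarNormal φ) φ := by
  rw [polarNormal_eq, funext polarDir_eq]
  exact ((Real.hasDerivAt_cos φ).smul_const _).add ((Real.hasDerivAt_sin φ).smul_const _)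

lemma hasDerivAt_polarNormal (φ : ℝ) : HasDerivAt polarNormal (-polarDir φ) φ := by
  rw [polarDir_eq, funext polarNormal_eq]
  refine (((Real.hasDerivAt_sin φ).neg.smul_const _).add
    ((Real.hasDerivAt_cos φ).smul_const _)).congr_deriv ?_
  module

lemma continuous_polarDir : Continuous polarDir :=
  continuous_iff_continuousAt.2 fun φ => (hasDerivAt_polarDir φ).continuousAt

lemma continuous_polarNormal : Continuous polarNormal :=
  continuous_iff_continuousAt.2 fun φ => (hasDerivAt_polarNormal φ).continuousAt

lemma polarDir_periodic : Function.Periodic polarDir (2 * Real.pi) := fun φ => by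
  simp [polarDir]

lemma polarNormal_periodic : Function.Periodic polarNormal (2 * Real.pi) := fun φ => by
  simp [polarNormal]

lemma polar_mem_ball (p : Plane) {r R : ℝ} (hr : |r| < R) (φ : ℝ) :
    p + r • polarDir φ ∈ Metric.ball p R := by
  simpa [norm_smul, norm_polarDir] using hr

/-- Polar coordinates centred at `p`; for `x = p` the angle is arbitrary. -/
lemma exists_polar (p x : Plane) : ∃ φ : ℝ, x = p + dist x p • polarDir φ := by
  refine ⟨Complex.arg ⟨(x - p) 0, (x - p) 1⟩, ?_⟩
  set z : ℂ := ⟨(x - p) 0, (x - p) 1⟩ with hz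
  have hn : dist x p = ‖z‖ := by
    rw [dist_eq_norm, EuclideanSpace.norm_eq, Complex.norm_def, Complex.normSq_apply]
    simp [hz, sq]
  rw [hn]
  ext i
  fin_cases i
  · simp [polarDir, hz]
  · simp [polarDir, hz]

lemma laplacian_eq_polar (u : Plane → ℂ) (x : Plane) (φ : ℝ) :
    Laplacian.laplacian u x = fderiv ℝ (fderiv ℝ u) x (polarDir φ) (polarDir φ) +
      fderiv ℝ (fderiv ℝ u) x (polarNormal φ) (polarNormal φ) := by
  rw [InnerProductSpace.laplacian_eq_iteratedFDeriv_orthonormalBasis u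
    (EuclideanSpace.basisFun (Fin 2) ℝ), polarDir_eq, polarNormal_eq]
  simp only [Fin.sum_univ_two, iteratedFDeriv_two_apply, EuclideanSpace.basisFun_apply, map_add,
    map_smul, add_apply, smul_apply, Matrix.cons_val_zero,
    Matrix.cons_val_one]
  have h : (Real.cos φ : ℂ) ^ 2 + (Real.sin φ : ℂ) ^ 2 = 1 := by
    exact_mod_cast Real.cos_sq_add_sin_sq φ
  simp only [Complex.real_smul, Complex.ofReal_neg]
  linear_combination (-1 : ℂ) * (fderiv ℝ (fderiv ℝ u) x (stdVec 0) (stdVec 0) +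
    fderiv ℝ (fderiv ℝ u) x (stdVec 1) (stdVec 1)) * h

section Polar

variable {u : Plane → ℂ} {p : Plane} {R : ℝ}

lemma hasFDerivAt_of_contDiffOn {s : Set Plane} (hs : IsOpen s) (hu : ContDiffOn ℝ 2 u s)
    {x : Plane} (hx : x ∈ s) : HasFDerivAt u (fderiv ℝ u x) x :=
  ((hu.differentiableOn (by norm_num)).differentiableAt (hs.mem_nhds hx)).hasFDerivAt

lemma contDiffOn_fderiv {s : Set Plane} (hs : IsOpen s) (hu : ContDiffOn ℝ 2 u s) :
    ContDiffOn ℝ 1 (fderiv ℝ u) s :=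
  hu.fderiv_of_isOpen hs (by norm_num)

lemma hasFDerivAt_fderiv_of_contDiffOn {s : Set Plane} (hs : IsOpen s) (hu : ContDiffOn ℝ 2 u s)
    {x : Plane} (hx : x ∈ s) : HasFDerivAt (fderiv ℝ u) (fderiv ℝ (fderiv ℝ u) x) x :=
  (((contDiffOn_fderiv hs hu).differentiableOn (by norm_num)).differentiableAt
    (hs.mem_nhds hx)).hasFDerivAt

lemma hasDerivAt_radial (r φ : ℝ) :
    HasDerivAt (fun r : ℝ => p + r • polarDir φ) (polarDir φ) r := by
  simpa using ((hasDerivAt_id r).smul_const (polarDir φ)).const_add p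

lemma hasDerivAt_angular (r φ : ℝ) :
    HasDerivAt (fun φ : ℝ => p + r • polarDir φ) (r • polarNormal φ) φ :=
  ((hasDerivAt_polarDir φ).const_smul r).const_add p

/-- Differentiation under the integral over a period, for integrands that are continuous together
with their derivative in the parameter. -/
lemma hasDerivAt_integral_period {F F' : ℝ → ℝ → ℂ}
    (hF : ∀ r, |r| < R → Continuous (F r))
    (hF' : ContinuousOn (Function.uncurry F') {q | |q.1| < R})
    (hd : ∀ r φ, |r| < R → HasDerivAt (fun r => F r φ) (F' r φ) r) {r : ℝ} (hr : |r| < R) :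
    HasDerivAt (fun r => ∫ φ in (0 : ℝ)..2 * Real.pi, F r φ)
      (∫ φ in (0 : ℝ)..2 * Real.pi, F' r φ) r := by
  obtain ⟨δ, hδ, hδR⟩ : ∃ δ > 0, ∀ s ∈ Metric.closedBall r δ, |s| < R := by
    refine ⟨(R - |r|) / 2, by linarith, fun s hs => ?_⟩
    rw [Metric.mem_closedBall, Real.dist_eq] at hs
    have := abs_sub_abs_le_abs_sub s r
    linarith
  have hcpt : IsCompact (Metric.closedBall r δ ×ˢ Set.Icc (0 : ℝ) (2 * Real.pi)) :=
    (isCompact_closedBall r δ).prod isCompact_Icc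
  obtain ⟨M, hM⟩ := hcpt.exists_bound_of_continuousOn
    (hF'.mono fun q hq => hδR q.1 hq.1)
  have hF'c : Continuous (F' r) := by
    rw [← continuousOn_univ]
    exact hF'.comp (f := fun φ => (r, φ)) (by fun_prop) fun φ _ => hr
  refine (intervalIntegral.hasDerivAt_integral_of_dominated_loc_of_deriv_le
    (F := F) (F' := F') (bound := fun _ => M) (Metric.ball_mem_nhds r hδ) ?_ ?_ ?_ ?_ ?_ ?_).2
  · filter_upwards [Metric.ball_mem_nhds r hδ] with s hs
    exact (hF s (hδR s (Metric.ball_subset_closedBall hs))).aestronglyMeasurable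
  · exact (hF r hr).intervalIntegrable _ _
  · exact hF'c.aestronglyMeasurable
  · refine Eventually.of_forall fun φ hφ s hs => ?_
    rw [Set.uIoc_of_le (by positivity)] at hφ
    exact hM (s, φ) ⟨Metric.ball_subset_closedBall hs, hφ.1.le, hφ.2⟩
  · exact intervalIntegrable_const
  · exact Eventually.of_forall fun φ _ s hs => hd s φ (hδR s (Metric.ball_subset_closedBall hs))

/-- The character `e^{-i n φ}`. -/
noncomputable def angularChar (n : ℤ) (φ : ℝ) : ℂ := Complex.exp (-(Complex.I * n * φ))

lemma hasDerivAt_angularChar (n : ℤ) (φ : ℝ) :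
    HasDerivAt (angularChar n) (-(Complex.I * n) * angularChar n φ) φ := by
  have h : HasDerivAt (fun φ : ℝ => -(Complex.I * n * (φ : ℂ))) (-(Complex.I * n)) φ := by
    have h := ((hasDerivAt_id φ).ofReal_comp.const_mul (Complex.I * n)).neg
    simp only [id, Complex.ofReal_one, mul_one] at h
    exact h
  exact h.cexp.congr_deriv (mul_comm _ _)

lemma continuous_angularChar (n : ℤ) : Continuous (angularChar n) := by
  unfold angularChar; fun_prop

lemma norm_angularChar (n : ℤ) (φ : ℝ) : ‖angularChar n φ‖ = 1 := by
  rw [angularChar, show -(Complex.I * n * φ) = ((-(n * φ) : ℝ) : ℂ) * Complex.I by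
    push_cast; ring, Complex.norm_exp_ofReal_mul_I]

lemma angularChar_periodic (n : ℤ) : Function.Periodic (angularChar n) (2 * Real.pi) := fun φ => by
  rw [angularChar, angularChar, Complex.exp_eq_exp_iff_exists_int]
  exact ⟨-n, by push_cast; ring⟩

/-- Integration by parts over a period. -/
lemma integral_deriv_mul_angularChar {V V' : ℝ → ℂ} (hV : ∀ φ, HasDerivAt V (V' φ) φ)
    (hV' : Continuous V') (hper : Function.Periodic V (2 * Real.pi)) (n : ℤ) :
    ∫ φ in (0 : ℝ)..2 * Real.pi, V' φ * angularChar n φ =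
      Complex.I * n * ∫ φ in (0 : ℝ)..2 * Real.pi, V φ * angularChar n φ := by
  have hVc : Continuous V := continuous_iff_continuousAt.2 fun φ => (hV φ).continuousAt
  have hc := continuous_angularChar n
  have h := intervalIntegral.integral_eq_sub_of_hasDerivAt (a := 0) (b := 2 * Real.pi)
    (fun φ _ => (hV φ).mul (hasDerivAt_angularChar n φ))
    (by apply Continuous.intervalIntegrable; fun_prop)
  have h0 : V (2 * Real.pi) = V 0 := by simpa using hper 0
  have h1 : angularChar n (2 * Real.pi) = angularChar n 0 := by
    simpa using angularChar_periodic n 0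
  rw [intervalIntegral.integral_add (by apply Continuous.intervalIntegrable; fun_prop)
    (by apply Continuous.intervalIntegrable; fun_prop)] at h
  have h2 : ∫ φ in (0 : ℝ)..2 * Real.pi, V φ * (-(Complex.I * n) * angularChar n φ) =
      -(Complex.I * n) * ∫ φ in (0 : ℝ)..2 * Real.pi, V φ * angularChar n φ := by
    rw [← intervalIntegral.integral_const_mul]
    congr 1
    ext φ
    ring
  rw [h2] at h
  simp only [Pi.mul_apply, h0, h1, sub_self] at h
  linear_combination h

/-- A continuous `2π`-periodic function with summable Fourier coefficients is the pointwise sum of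
its Fourier series. -/
lemma hasSum_of_fourierCoeff {V : ℝ → ℂ} (hV : Continuous V)
    (hper : Function.Periodic V (2 * Real.pi)) {c : ℤ → ℂ} (hc : Summable c)
    (hcV : ∀ n, ∫ φ in (0 : ℝ)..2 * Real.pi, V φ * angularChar n φ = 2 * Real.pi * c n) (φ : ℝ) :
    HasSum (fun n : ℤ => c n * Complex.exp (Complex.I * n * φ)) (V φ) := by
  have : Fact (0 < 2 * Real.pi) := ⟨by positivity⟩
  let g : C(AddCircle (2 * Real.pi), ℂ) := ⟨hper.lift, hV.quotient_liftOn' _⟩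
  have hg : ∀ x : ℝ, g (x : AddCircle (2 * Real.pi)) = V x := fun x => hper.lift_coe x
  have hf : ∀ (n : ℤ) (x : ℝ), fourier n (x : AddCircle (2 * Real.pi)) =
      Complex.exp (Complex.I * n * x) := fun n x => by
    rw [fourier_coe_apply]
    congr 1
    push_cast
    field_simp
  have hcoef : fourierCoeff g = c := by
    ext n
    rw [fourierCoeff_eq_intervalIntegral _ n 0, zero_add]
    simp only [hg, hf]
    have : (∫ x in (0 : ℝ)..2 * Real.pi, Complex.exp (Complex.I * ((-n : ℤ) : ℂ) * x) • V x) =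
        2 * Real.pi * c n := by
      rw [← hcV n]
      congr 1
      ext x
      rw [angularChar, smul_eq_mul, mul_comm]
      congr 2
      push_cast
      ring
    rw [this, Complex.real_smul]
    push_cast
    field_simp
  have h := has_pointwise_sum_fourier_series_of_summable (f := g) (by rwa [hcoef])
    (φ : AddCircle (2 * Real.pi))
  simpa only [hcoef, hf, hg, smul_eq_mul] using h

section Helmholtz

variable {k : ℝ}

/-- The integral of `u` against `e^{-i n φ}` over the circle of radius `r` about `p`, that is,
`2π` times an angular Fourier coefficient. -/
noncomputable def angularMoment (u : Plane → ℂ) (p : Plane) (n : ℤ) (r : ℝ) : ℂ :=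
  ∫ φ in (0 : ℝ)..2 * Real.pi, u (p + r • polarDir φ) * angularChar n φ

lemma continuous_polarMap (p : Plane) : Continuous fun q : ℝ × ℝ => p + q.1 • polarDir q.2 :=
  continuous_const.add (continuous_fst.smul (continuous_polarDir.comp continuous_snd))

lemma hasDerivAt_angular_comp (hu : ContDiffOn ℝ 2 u (Metric.ball p R)) {r : ℝ} (hr : |r| < R)
    (φ : ℝ) : HasDerivAt (fun φ => u (p + r • polarDir φ))
      (fderiv ℝ u (p + r • polarDir φ) (r • polarNormal φ)) φ :=
  (hasFDerivAt_of_contDiffOn Metric.isOpen_ball hu (polar_mem_ball p hr φ)).comp_hasDerivAt φ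
    (hasDerivAt_angular r φ)

lemma hasDerivAt_angular_fderiv (hu : ContDiffOn ℝ 2 u (Metric.ball p R)) {r : ℝ} (hr : |r| < R)
    (φ : ℝ) : HasDerivAt (fun φ => fderiv ℝ u (p + r • polarDir φ) (r • polarNormal φ))
      (fderiv ℝ (fderiv ℝ u) (p + r • polarDir φ) (r • polarNormal φ) (r • polarNormal φ) +
        fderiv ℝ u (p + r • polarDir φ) (r • -polarDir φ)) φ := by
  have h1 : HasDerivAt (fun φ => fderiv ℝ u (p + r • polarDir φ))
      (fderiv ℝ (fderiv ℝ u) (p + r • polarDir φ) (r • polarNormal φ)) φ :=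
    (hasFDerivAt_fderiv_of_contDiffOn Metric.isOpen_ball hu
      (polar_mem_ball p hr φ)).comp_hasDerivAt φ (hasDerivAt_angular r φ)
  have h2 : HasDerivAt (fun φ => r • polarNormal φ) (r • -polarDir φ) φ :=
    (hasDerivAt_polarNormal φ).const_smul r
  exact h1.clm_apply h2

lemma continuous_angular_fderiv (hu : ContDiffOn ℝ 2 u (Metric.ball p R)) {r : ℝ} (hr : |r| < R) :
    Continuous fun φ => fderiv ℝ u (p + r • polarDir φ) (r • polarNormal φ) :=
  continuous_iff_continuousAt.2 fun φ => (hasDerivAt_angular_fderiv hu hr φ).continuousAt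

/-- The angular derivative multiplies the angular moment of order `n` by `i n`. -/
lemma integral_angular_fderiv (hu : ContDiffOn ℝ 2 u (Metric.ball p R)) {r : ℝ} (hr : |r| < R)
    (n : ℤ) : ∫ φ in (0 : ℝ)..2 * Real.pi,
      fderiv ℝ u (p + r • polarDir φ) (r • polarNormal φ) * angularChar n φ =
        Complex.I * n * angularMoment u p n r :=
  integral_deriv_mul_angularChar (hasDerivAt_angular_comp hu hr) (continuous_angular_fderiv hu hr)
    (fun φ => by simp only [polarDir_periodic φ]) n

lemma continuousOn_fderiv_fderiv {s : Set Plane} (hs : IsOpen s) (hu : ContDiffOn ℝ 2 u s) :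
    ContinuousOn (fderiv ℝ (fderiv ℝ u)) s :=
  ((contDiffOn_fderiv hs hu).fderiv_of_isOpen hs (m := 0) (by norm_num)).continuousOn

/-- Bessel's equation for the angular moments of a solution of the Helmholtz equation. -/
lemma angularMoment_ode (hu : ContDiffOn ℝ 2 u (Metric.ball p R))
    (hΔ : ∀ x ∈ Metric.ball p R, Laplacian.laplacian u x + (k : ℂ) ^ 2 * u x = 0) (n : ℤ) :
    ∃ y₁ y₂ : ℝ → ℂ, ∀ r, |r| < R → HasDerivAt (angularMoment u p n) (y₁ r) r ∧
      HasDerivAt y₁ (y₂ r) r ∧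
      (r : ℂ) ^ 2 * y₂ r + r * y₁ r + ((k : ℂ) ^ 2 * r ^ 2 - n ^ 2) * angularMoment u p n r = 0 := by
  have hD1 := (contDiffOn_fderiv Metric.isOpen_ball hu).continuousOn
  have hD2 := continuousOn_fderiv_fderiv Metric.isOpen_ball hu
  have hmaps : Set.MapsTo (fun q : ℝ × ℝ => p + q.1 • polarDir q.2) {q | |q.1| < R}
    (Metric.ball p R) := fun q hq => polar_mem_ball p hq q.2
  have hpol := (continuous_polarMap p).continuousOn (s := {q | |q.1| < R})
  have hdir : ContinuousOn (fun q : ℝ × ℝ => polarDir q.2) {q | |q.1| < R} :=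
    (continuous_polarDir.comp continuous_snd).continuousOn
  have hnor : ContinuousOn (fun q : ℝ × ℝ => q.1 • polarNormal q.2) {q | |q.1| < R} :=
    (continuous_fst.smul (continuous_polarNormal.comp continuous_snd)).continuousOn
  have hndir : ContinuousOn (fun q : ℝ × ℝ => q.1 • -polarDir q.2) {q | |q.1| < R} :=
    (continuous_fst.smul (continuous_polarDir.comp continuous_snd).neg).continuousOn
  have hchar : ContinuousOn (fun q : ℝ × ℝ => angularChar n q.2) {q | |q.1| < R} :=
    ((continuous_angularChar n).comp continuous_snd).continuousOn
  have hF0 : ContinuousOn (Function.uncurry fun r φ => u (p + r • polarDir φ) * angularChar n φ)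
      {q | |q.1| < R} := (hu.continuousOn.comp hpol hmaps).mul hchar
  have hF1 : ContinuousOn (Function.uncurry fun r φ =>
      fderiv ℝ u (p + r • polarDir φ) (polarDir φ) * angularChar n φ) {q | |q.1| < R} :=
    ((hD1.comp hpol hmaps).clm_apply hdir).mul hchar
  have hF2 : ContinuousOn (Function.uncurry fun r φ =>
      fderiv ℝ (fderiv ℝ u) (p + r • polarDir φ) (polarDir φ) (polarDir φ) * angularChar n φ)
      {q | |q.1| < R} :=
    (((hD2.comp hpol hmaps).clm_apply hdir).clm_apply hdir).mul hchar
  have hF3 : ContinuousOn (Function.uncurry fun r φ =>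
      fderiv ℝ (fderiv ℝ u) (p + r • polarDir φ) (r • polarNormal φ) (r • polarNormal φ) +
        fderiv ℝ u (p + r • polarDir φ) (r • -polarDir φ)) {q | |q.1| < R} :=
    (((hD2.comp hpol hmaps).clm_apply hnor).clm_apply hnor).add
      ((hD1.comp hpol hmaps).clm_apply hndir)
  have hslice : ∀ {F : ℝ → ℝ → ℂ}, ContinuousOn (Function.uncurry F) {q | |q.1| < R} →
      ∀ r, |r| < R → Continuous (F r) := fun {F} hF r hr => by
    rw [← continuousOn_univ]
    exact hF.comp (f := fun φ => (r, φ)) (by fun_prop) fun φ _ => hr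
  refine ⟨fun r => ∫ φ in (0 : ℝ)..2 * Real.pi,
      fderiv ℝ u (p + r • polarDir φ) (polarDir φ) * angularChar n φ,
    fun r => ∫ φ in (0 : ℝ)..2 * Real.pi,
      fderiv ℝ (fderiv ℝ u) (p + r • polarDir φ) (polarDir φ) (polarDir φ) * angularChar n φ,
    fun r hr => ⟨?_, ?_, ?_⟩⟩
  · refine hasDerivAt_integral_period (hslice hF0) hF1 (fun r φ hr => ?_) hr
    exact ((hasFDerivAt_of_contDiffOn Metric.isOpen_ball hu (polar_mem_ball p hr φ)).comp_hasDerivAt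
      r (hasDerivAt_radial r φ)).mul_const _
  · refine hasDerivAt_integral_period (hslice hF1) hF2 (fun r φ hr => ?_) hr
    have h1 : HasDerivAt (fun r : ℝ => fderiv ℝ u (p + r • polarDir φ))
        (fderiv ℝ (fderiv ℝ u) (p + r • polarDir φ) (polarDir φ)) r :=
      (hasFDerivAt_fderiv_of_contDiffOn Metric.isOpen_ball hu
        (polar_mem_ball p hr φ)).comp_hasDerivAt r (hasDerivAt_radial r φ)
    have h2 := h1.clm_apply (hasDerivAt_const r (polarDir φ))
    rw [map_zero, add_zero] at h2
    exact h2.mul_const _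
  · have h1 := integral_deriv_mul_angularChar (hasDerivAt_angular_fderiv hu hr) (hslice hF3 r hr)
      (fun φ => by simp only [polarDir_periodic φ, polarNormal_periodic φ]) n
    rw [integral_angular_fderiv hu hr] at h1
    -- in polar coordinates the Helmholtz equation reads `r² ∂ᵣ²u + r ∂ᵣu + ∂ᵩ²u + k² r² u = 0`
    have h2 : (∫ φ in (0 : ℝ)..2 * Real.pi,
        (fderiv ℝ (fderiv ℝ u) (p + r • polarDir φ) (r • polarNormal φ) (r • polarNormal φ) +
        fderiv ℝ u (p + r • polarDir φ) (r • -polarDir φ)) * angularChar n φ) =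
        ∫ φ in (0 : ℝ)..2 * Real.pi, (-(r : ℂ) ^ 2 *
          (fderiv ℝ (fderiv ℝ u) (p + r • polarDir φ) (polarDir φ) (polarDir φ) * angularChar n φ) -
          r * (fderiv ℝ u (p + r • polarDir φ) (polarDir φ) * angularChar n φ) -
          (k : ℂ) ^ 2 * r ^ 2 * (u (p + r • polarDir φ) * angularChar n φ)) := by
      congr 1
      ext φ
      have h := hΔ _ (polar_mem_ball p hr φ)
      rw [laplacian_eq_polar _ _ φ] at h
      simp only [map_smul, smul_apply, map_neg, Complex.real_smul]
      linear_combination r ^ 2 * angularChar n φ * h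
    have i0 := (hslice hF0 r hr).intervalIntegrable (μ := volume) 0 (2 * Real.pi)
    have i1 := (hslice hF1 r hr).intervalIntegrable (μ := volume) 0 (2 * Real.pi)
    have i2 := (hslice hF2 r hr).intervalIntegrable (μ := volume) 0 (2 * Real.pi)
    rw [h2, intervalIntegral.integral_sub ((i2.const_mul _).sub (i1.const_mul _)) (i0.const_mul _),
      intervalIntegral.integral_sub (i2.const_mul _) (i1.const_mul _),
      intervalIntegral.integral_const_mul, intervalIntegral.integral_const_mul,
      intervalIntegral.integral_const_mul] at h1
    rw [← angularMoment] at h1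
    linear_combination -h1 - (n : ℂ) ^ 2 * angularMoment u p n r * Complex.I_sq

end Helmholtz
end Polar

/-! ### Angular expansion of solutions of the Helmholtz equation -/

section Expansion

variable {u : Plane → ℂ} {p : Plane} {R k : ℝ}

/-- A function that has derivative zero on an open interval is constant there. -/
lemma exists_const_of_hasDerivAt_zero {g : ℝ → ℂ} {a b : ℝ} (hab : a < b)
    (hg : ∀ r ∈ Set.Ioo a b, HasDerivAt g 0 r) : ∃ c, ∀ r ∈ Set.Ioo a b, g r = c := by
  refine ⟨g ((a + b) / 2), fun r hr => ?_⟩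
  exact isOpen_Ioo.is_const_of_deriv_eq_zero isPreconnected_Ioo
    (fun x hx => (hg x hx).differentiableAt.differentiableWithinAt)
    (fun x hx => (hg x hx).deriv) hr ⟨by linarith, by linarith⟩

/-- An angular moment of a solution of the Helmholtz equation is a multiple of the regular solution
of Bessel's equation: the Wronskian of the two, times the radius, is constant and vanishes at the
centre. -/
lemma exists_angularMoment_eq (hu : ContDiffOn ℝ 2 u (Metric.ball p R))
    (hΔ : ∀ x ∈ Metric.ball p R, Laplacian.laplacian u x + (k : ℂ) ^ 2 * u x = 0) {ρ : ℝ}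
    (hρ : 0 < ρ) (hρR : ρ ≤ R) (hkρ : |k| * ρ ≤ 1) (n : ℤ) :
    ∃ a : ℂ, ∀ r ∈ Set.Ioo 0 ρ, angularMoment u p n r = a * radialMode k n.natAbs r := by
  obtain ⟨y₁, y₂, hy⟩ := angularMoment_ode (k := k) hu hΔ n
  set y := angularMoment u p n
  set N := n.natAbs
  have hN : ((N : ℝ) : ℂ) ^ 2 = (n : ℂ) ^ 2 := by
    have : ((N : ℤ)) ^ 2 = n ^ 2 := by simp [N]
    exact_mod_cast congrArg (Int.cast : ℤ → ℂ) this
  have habs : ∀ r ∈ Set.Ioo 0 ρ, |r| < R := fun r hr => by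
    rw [abs_of_pos hr.1]; linarith [hr.2]
  have hj : ∀ r, HasDerivAt (fun r => (radialMode k N r : ℂ)) (radialModeDeriv k N r) r :=
    fun r => (hasDerivAt_radialMode k N r).ofReal_comp
  have hjpos : ∀ r ∈ Set.Ioo 0 ρ, (radialMode k N r : ℂ) ≠ 0 := fun r hr => by
    have h1 := (radialMode_bounds k N hr.1.le
      ((mul_le_mul_of_nonneg_left hr.2.le (abs_nonneg k)).trans hkρ)).1
    have h2 : 0 < r ^ N := pow_pos hr.1 _
    exact_mod_cast (by linarith : 0 < radialMode k N r).ne'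
  set W : ℝ → ℂ := fun r => r * (y₁ r * radialMode k N r - y r * radialModeDeriv k N r) with hW
  have hW' : ∀ r, |r| < R → ∃ D : ℂ, HasDerivAt W D r ∧ r * D = 0 := fun r hr => by
    obtain ⟨h1, h2, h3⟩ := hy r hr
    obtain ⟨E, hE, hE'⟩ := exists_hasDerivAt_radialModeDeriv k N r
    have hEc := hE.ofReal_comp
    refine ⟨_, ((hasDerivAt_id r).ofReal_comp).mul ((h2.mul (hj r)).sub (h1.mul hEc)), ?_⟩
    have hE'' : (r : ℂ) ^ 2 * E + r * radialModeDeriv k N r +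
        ((k : ℂ) ^ 2 * r ^ 2 - (n : ℂ) ^ 2) * radialMode k N r = 0 := by
      rw [← hN]; exact_mod_cast hE'
    simp only [id, Complex.ofReal_one]
    linear_combination (radialMode k N r : ℂ) * h3 - y r * hE''
  have hR0 : |(0 : ℝ)| < R := by rw [abs_zero]; linarith
  obtain ⟨c, hc⟩ := exists_const_of_hasDerivAt_zero hρ (g := W) fun r hr => by
    obtain ⟨D, hD, hD0⟩ := hW' r (habs r hr)
    rcases mul_eq_zero.1 hD0 with h | h
    · exact absurd h (by exact_mod_cast hr.1.ne')
    · rwa [h] at hD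
  have hc0 : c = 0 := by
    obtain ⟨D, hD, -⟩ := hW' 0 hR0
    have h1 : Tendsto W (nhdsWithin 0 (Set.Ioi 0)) (nhds 0) := by
      have := hD.continuousAt.tendsto.mono_left (nhdsWithin_le_nhds (s := Set.Ioi (0 : ℝ)))
      simpa [hW] using this
    have h2 : Tendsto W (nhdsWithin 0 (Set.Ioi 0)) (nhds c) := by
      refine tendsto_const_nhds.congr' ?_
      filter_upwards [Ioo_mem_nhdsGT hρ] with r hr using (hc r hr).symm
    exact tendsto_nhds_unique h2 h1
  obtain ⟨a, ha⟩ := exists_const_of_hasDerivAt_zero hρ (g := fun r => y r / radialMode k N r)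
    fun r hr => by
      refine ((hy r (habs r hr)).1.div (hj r) (hjpos r hr)).congr_deriv ?_
      have h := hc r hr
      rw [hc0] at h
      rcases mul_eq_zero.1 h with h | h
      · exact absurd h (by exact_mod_cast hr.1.ne')
      · rw [h, zero_div]
  exact ⟨a, fun r hr => (div_eq_iff (hjpos r hr)).1 (ha r hr)⟩

lemma summable_natAbs_pow {x : ℝ} (hx0 : 0 ≤ x) (hx : x < 1) :
    Summable fun n : ℤ => ((n.natAbs : ℝ) + 1) * x ^ n.natAbs := by
  have h : Summable fun n : ℕ => ((n : ℝ) + 1) * x ^ n := by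
    have h1 := summable_pow_mul_geometric_of_norm_lt_one 1 (r := x)
      (by rwa [Real.norm_eq_abs, abs_of_nonneg hx0])
    refine (h1.add (summable_geometric_of_lt_one hx0 hx)).congr fun n => ?_
    ring
  exact Summable.of_nat_of_neg (by simpa using h) (by simpa using h)

/-- The coefficients of the expansion of a solution of the Helmholtz equation into regular
solutions with separated polar variables, and the expansions of the solution and of its angular
derivative. -/
theorem exists_angular_expansion (hu : ContDiffOn ℝ 2 u (Metric.ball p R))
    (hΔ : ∀ x ∈ Metric.ball p R, Laplacian.laplacian u x + (k : ℂ) ^ 2 * u x = 0) {ρ : ℝ}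
    (hρ : 0 < ρ) (hρR : 2 * ρ ≤ R) (hkρ : |k| * (2 * ρ) ≤ 1) :
    ∃ a : ℤ → ℂ, ∃ C : ℝ, (∀ n, ‖a n‖ ≤ C / ρ ^ n.natAbs) ∧
      (∀ r ∈ Set.Ioo 0 ρ, ∀ n,
        angularMoment u p n r = 2 * Real.pi * (a n * radialMode k n.natAbs r)) ∧
      (∀ r ∈ Set.Ioo 0 ρ, ∀ φ : ℝ, HasSum (fun n : ℤ => a n * radialMode k n.natAbs r *
        Complex.exp (Complex.I * n * φ)) (u (p + r • polarDir φ))) ∧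
      ∀ r ∈ Set.Ioo 0 ρ, ∀ φ : ℝ, HasSum (fun n : ℤ => Complex.I * n * a n *
        radialMode k n.natAbs r * Complex.exp (Complex.I * n * φ))
        (fderiv ℝ u (p + r • polarDir φ) (r • polarNormal φ)) := by
  choose b hb using exists_angularMoment_eq hu hΔ (by linarith : 0 < 2 * ρ) hρR hkρ
  have hpi : (Real.pi : ℂ) ≠ 0 := by exact_mod_cast Real.pi_ne_zero
  have hcont : ∀ r, |r| < R → Continuous fun φ => u (p + r • polarDir φ) := fun r hr =>
    continuous_iff_continuousAt.2 fun φ => (hasDerivAt_angular_comp hu hr φ).continuousAt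
  have habs : ∀ r ∈ Set.Ioo 0 (2 * ρ), |r| < R := fun r hr => by
    rw [abs_of_pos hr.1]; linarith [hr.2]
  have hkr : ∀ r ∈ Set.Ioo 0 (2 * ρ), |k| * r ≤ 1 := fun r hr =>
    (mul_le_mul_of_nonneg_left hr.2.le (abs_nonneg k)).trans hkρ
  have hρ2 : ρ ∈ Set.Ioo 0 (2 * ρ) := ⟨hρ, by linarith⟩
  have hsub : ∀ r ∈ Set.Ioo 0 ρ, r ∈ Set.Ioo 0 (2 * ρ) := fun r hr => ⟨hr.1, by linarith [hr.2]⟩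
  obtain ⟨M, hM⟩ := (isCompact_Icc (a := (0 : ℝ)) (b := 2 * Real.pi)).exists_bound_of_continuousOn
    (hcont ρ (habs ρ hρ2)).continuousOn
  -- the coefficients are bounded by evaluating the moments at half of the available radius
  set a : ℤ → ℂ := fun n => b n / (2 * Real.pi) with ha
  have hbound : ∀ n, ‖a n‖ ≤ 2 * M / ρ ^ n.natAbs := fun n => by
    have h1 : ‖angularMoment u p n ρ‖ ≤ M * |2 * Real.pi - 0| := by
      refine intervalIntegral.norm_integral_le_of_norm_le_const fun φ hφ => ?_
      rw [Set.uIoc_of_le (by positivity)] at hφ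
      rw [norm_mul, norm_angularChar, mul_one]
      exact hM φ ⟨hφ.1.le, hφ.2⟩
    have h2 := (radialMode_bounds k n.natAbs hρ.le (hkr ρ hρ2)).1
    have h3 : 0 < ρ ^ n.natAbs := by positivity
    rw [hb n ρ hρ2, norm_mul, Complex.norm_real, Real.norm_eq_abs,
      abs_of_nonneg (by linarith), sub_zero, abs_of_pos (by positivity)] at h1
    rw [ha, norm_div, div_le_div_iff₀ (by simp [Real.pi_pos.ne']) h3]
    have h4 : ‖(2 * Real.pi : ℂ)‖ = 2 * Real.pi := by
      rw [norm_mul, Complex.norm_real, Real.norm_eq_abs, abs_of_pos Real.pi_pos]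
      norm_num
    rw [h4]
    nlinarith [norm_nonneg (b n)]
  have hmom : ∀ r ∈ Set.Ioo 0 ρ, ∀ n,
      angularMoment u p n r = 2 * Real.pi * (a n * radialMode k n.natAbs r) := fun r hr n => by
    rw [hb n r (hsub r hr), ha]
    field_simp
  have hbd : ∀ r ∈ Set.Ioo 0 ρ, ∀ n : ℤ,
      ‖a n * radialMode k n.natAbs r‖ ≤ 3 * M * (r / ρ) ^ n.natAbs := fun r hr n => by
    have hj := radialMode_bounds k n.natAbs hr.1.le (hkr r (hsub r hr))
    have hrp : 0 < r ^ n.natAbs := pow_pos hr.1 _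
    have h3 : 0 < ρ ^ n.natAbs := by positivity
    rw [norm_mul, Complex.norm_real, Real.norm_eq_abs, abs_of_nonneg (by linarith)]
    calc _ ≤ 2 * M / ρ ^ n.natAbs * (3 / 2 * r ^ n.natAbs) :=
          mul_le_mul (hbound n) hj.2 (by linarith) ((norm_nonneg _).trans (hbound n))
      _ = _ := by rw [div_pow]; ring
  have hsum : ∀ r ∈ Set.Ioo 0 ρ,
      Summable fun n : ℤ => ((n.natAbs : ℝ) + 1) * (3 * M * (r / ρ) ^ n.natAbs) := fun r hr => by
    refine ((summable_natAbs_pow (x := r / ρ) (div_nonneg hr.1.le hρ.le)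
      ((div_lt_one hρ).2 hr.2)).mul_left (3 * M)).congr fun n => ?_
    ring
  have hM0 : 0 ≤ M := (norm_nonneg _).trans (hM 0 ⟨le_rfl, by positivity⟩)
  refine ⟨a, 2 * M, hbound, hmom, fun r hr φ => ?_, fun r hr φ => ?_⟩
  · refine hasSum_of_fourierCoeff (hcont r (habs r (hsub r hr)))
      (fun φ => by simp only [polarDir_periodic φ]) ?_ (hmom r hr) φ
    refine Summable.of_norm_bounded (hsum r hr) fun n => (hbd r hr n).trans ?_
    refine le_mul_of_one_le_left ?_ (by simp)
    have := hr.1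
    positivity
  · refine hasSum_of_fourierCoeff (continuous_angular_fderiv hu (habs r (hsub r hr)))
      (fun φ => by simp only [polarDir_periodic φ, polarNormal_periodic φ])
      (Summable.of_norm_bounded (hsum r hr) fun n => ?_) (fun n => ?_) φ
    · rw [mul_assoc, norm_mul, norm_mul, Complex.norm_I, one_mul]
      refine mul_le_mul ?_ (hbd r hr n) (norm_nonneg _) (by positivity)
      rw [Complex.norm_intCast, ← Int.cast_abs, Int.abs_eq_natAbs]
      simp
    · rw [integral_angular_fderiv hu (habs r (hsub r hr)), hmom r hr]
      ring

/-- The leading coefficient at the centre of a series of regular radial modes. -/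
lemma tendsto_div_pow_of_hasSum {ρ : ℝ} (hρ : 0 < ρ) (hkρ : |k| * ρ ≤ 1) {b : ℤ → ℂ} {C : ℝ}
    (hb : ∀ n, ‖b n‖ ≤ ((n.natAbs : ℝ) + 1) * (C / ρ ^ n.natAbs)) {m : ℕ}
    (hbm : ∀ n : ℤ, n.natAbs < m → b n = 0) {S : ℝ → ℂ} {φ : ℝ}
    (hS : ∀ r ∈ Set.Ioo 0 ρ, HasSum (fun n : ℤ => b n * radialMode k n.natAbs r *
        Complex.exp (Complex.I * n * φ)) (S r)) :
    Tendsto (fun r : ℝ => S r / (r : ℂ) ^ m) (nhdsWithin 0 (Set.Ioi 0))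
      (nhds (∑' n : ℤ, if n.natAbs = m then b n * Complex.exp (Complex.I * n * φ) else 0)) := by
  have hC : 0 ≤ C := by simpa using (norm_nonneg _).trans (hb 0)
  have hexp : ∀ n : ℤ, ‖Complex.exp (Complex.I * n * φ)‖ = 1 := fun n => by
    rw [show Complex.I * n * φ = ((n * φ : ℝ) : ℂ) * Complex.I by push_cast; ring,
      Complex.norm_exp_ofReal_mul_I]
  have hlim : ∀ n : ℕ, Tendsto (fun r : ℝ => ((besselSeries n (-(k ^ 2 / 4) * r ^ 2) : ℝ) : ℂ))
      (nhdsWithin 0 (Set.Ioi 0)) (nhds 1) := fun n => by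
    have h1 := (hasDerivAt_besselSeries_comp k n 0).continuousAt.tendsto
    have h2 : besselSeries n (-(k ^ 2 / 4) * (0 : ℝ) ^ 2) = 1 := by
      rw [besselSeries_eq]; simp
    rw [h2] at h1
    have h3 := (Complex.continuous_ofReal.tendsto (1 : ℝ)).comp
      (h1.mono_left (nhdsWithin_le_nhds (s := Set.Ioi 0)))
    rw [Complex.ofReal_one] at h3
    exact h3
  refine (tendsto_tsum_of_dominated_convergence
    (f := fun (r : ℝ) (n : ℤ) => b n * radialMode k n.natAbs r *
        Complex.exp (Complex.I * n * φ) / (r : ℂ) ^ m)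
    (bound := fun n : ℤ => 3 / 2 * C / (ρ / 2) ^ m * (((n.natAbs : ℝ) + 1) * (1 / 2) ^ n.natAbs))
    ((summable_natAbs_pow (by norm_num) (by norm_num)).mul_left _) (fun n => ?_) ?_).congr' ?_
  · rcases lt_trichotomy n.natAbs m with h | h | h
    · rw [if_neg h.ne, hbm n h]
      simp
    · rw [if_pos h]
      have := ((hlim n.natAbs).const_mul (b n * Complex.exp (Complex.I * n * φ)))
      rw [mul_one] at this
      refine this.congr' ?_
      filter_upwards [self_mem_nhdsWithin] with r hr
      have hr' : (r : ℂ) ≠ 0 := by exact_mod_cast (ne_of_gt hr)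
      rw [radialMode, h]
      push_cast
      field_simp
    · rw [if_neg h.ne']
      obtain ⟨d, hd⟩ := Nat.exists_eq_add_of_lt h
      have h0 : Tendsto (fun r : ℝ => (r : ℂ) ^ (d + 1)) (nhdsWithin 0 (Set.Ioi 0)) (nhds 0) := by
        have : Continuous fun r : ℝ => (r : ℂ) ^ (d + 1) := by fun_prop
        simpa using (this.tendsto 0).mono_left nhdsWithin_le_nhds
      have := (h0.mul (hlim n.natAbs)).const_mul (b n * Complex.exp (Complex.I * n * φ))
      rw [zero_mul, mul_zero] at this
      refine this.congr' ?_
      filter_upwards [self_mem_nhdsWithin] with r hr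
      have hr' : (r : ℂ) ≠ 0 := by exact_mod_cast (ne_of_gt hr)
      rw [radialMode, show r ^ n.natAbs = r ^ m * r ^ (d + 1) by rw [hd]; ring]
      push_cast
      field_simp
  · filter_upwards [Ioo_mem_nhdsGT (half_pos hρ)] with r hr n
    have hrρ : r ≤ ρ := by linarith [hr.2]
    have hj := radialMode_bounds k n.natAbs hr.1.le
      ((mul_le_mul_of_nonneg_left hrρ (abs_nonneg k)).trans hkρ)
    have hr0 := hr.1
    have hrp : 0 < r ^ n.natAbs := pow_pos hr.1 _
    rcases lt_or_ge n.natAbs m with h | h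
    · rw [hbm n h]
      simp only [zero_mul, zero_div, norm_zero]
      positivity
    · obtain ⟨d, hd⟩ := Nat.exists_eq_add_of_le h
      rw [norm_div, norm_mul, norm_mul, hexp, mul_one, Complex.norm_real, Real.norm_eq_abs,
        abs_of_nonneg (by linarith), norm_pow, Complex.norm_real, Real.norm_eq_abs,
        abs_of_pos hr.1, div_le_iff₀ (by positivity)]
      calc ‖b n‖ * radialMode k n.natAbs r
          ≤ ((n.natAbs : ℝ) + 1) * (C / ρ ^ n.natAbs) * (3 / 2 * r ^ n.natAbs) :=
            mul_le_mul (hb n) hj.2 (by linarith) ((norm_nonneg _).trans (hb n))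
        _ = 3 / 2 * C * ((n.natAbs : ℝ) + 1) * r ^ m * (r ^ d / ρ ^ n.natAbs) := by
            rw [show r ^ n.natAbs = r ^ m * r ^ d by rw [hd]; ring]
            ring
        _ ≤ 3 / 2 * C * ((n.natAbs : ℝ) + 1) * r ^ m * ((ρ / 2) ^ d / ρ ^ n.natAbs) := by
            gcongr
            exact hr.2.le
        _ = _ := by
            rw [show n.natAbs = m + d from hd]
            simp only [pow_add, div_pow, one_pow]
            field_simp
  · filter_upwards [Ioo_mem_nhdsGT hρ] with r hr
    exact ((hS r hr).div_const _).tsum_eq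

/-! ### Unique continuation -/

/-- `u` is a twice continuously differentiable solution of `Δu + k²u = 0` on `s`. -/
def SolvesHelmholtz (k : ℝ) (u : Plane → ℂ) (s : Set Plane) : Prop :=
  ContDiffOn ℝ 2 u s ∧ ∀ x ∈ s, Laplacian.laplacian u x + (k : ℂ) ^ 2 * u x = 0

lemma SolvesHelmholtz.mono {s t : Set Plane} (h : SolvesHelmholtz k u s) (hts : t ⊆ s) :
    SolvesHelmholtz k u t :=
  ⟨h.1.mono hts, fun x hx => h.2 x (hts hx)⟩

lemma SolvesHelmholtz.linearCombination {s : Set Plane} (hs : IsOpen s) {v : Plane → ℂ}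
    (hu : SolvesHelmholtz k u s) (hv : SolvesHelmholtz k v s) (c d : ℂ) :
    SolvesHelmholtz k (c • u + d • v) s := by
  refine ⟨(hu.1.const_smul c).add (hv.1.const_smul d), fun x hx => ?_⟩
  have hux := hu.1.contDiffAt (hs.mem_nhds hx)
  have hvx := hv.1.contDiffAt (hs.mem_nhds hx)
  have h1 : Laplacian.laplacian (c • u) x = c • Laplacian.laplacian u x := by
    have := hux.laplacian_CLM_comp_left (l := (ContinuousLinearMap.mul ℝ ℂ c))
    exact this
  have h2 : Laplacian.laplacian (d • v) x = d • Laplacian.laplacian v x := by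
    have := hvx.laplacian_CLM_comp_left (l := (ContinuousLinearMap.mul ℝ ℂ d))
    exact this
  have h3 : Laplacian.laplacian (c • u + d • v) x =
      Laplacian.laplacian (c • u) x + Laplacian.laplacian (d • v) x :=
    ContDiffAt.laplacian_add (hux.const_smul c) (hvx.const_smul d)
  rw [h3, h1, h2]
  simp only [smul_eq_mul, Pi.add_apply, Pi.smul_apply]
  linear_combination c * hu.2 x hx + d * hv.2 x hx

/-- Radii that are small with respect to both the wave length and a given length. -/
lemma exists_small_radius (k : ℝ) {R : ℝ} (hR : 0 < R) :
    ∃ ρ : ℝ, 0 < ρ ∧ 2 * ρ ≤ R ∧ |k| * (2 * ρ) ≤ 1 := by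
  refine ⟨min (R / 2) (1 / (2 * (|k| + 1))), by positivity, ?_, ?_⟩
  · linarith [min_le_left (R / 2) (1 / (2 * (|k| + 1)))]
  · have h := min_le_right (R / 2) (1 / (2 * (|k| + 1)))
    have h2 : (|k| + 1) * (2 * (1 / (2 * (|k| + 1)))) = 1 := by field_simp
    have h3 : 0 < min (R / 2) (1 / (2 * (|k| + 1))) := by positivity
    nlinarith [abs_nonneg k]

lemma eq_zero_of_hasSum_zero {a : ℤ → ℂ} {ρ : ℝ} (ha : ∀ n, a n = 0) (hp : u p = 0)
    (h : ∀ r ∈ Set.Ioo 0 ρ, ∀ φ : ℝ, HasSum (fun n : ℤ => a n * radialMode k n.natAbs r *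
        Complex.exp (Complex.I * n * φ)) (u (p + r • polarDir φ))) :
    ∀ x ∈ Metric.ball p ρ, u x = 0 := by
  intro x hx
  rcases eq_or_ne x p with rfl | hxp
  · exact hp
  · obtain ⟨φ, hφ⟩ := exists_polar p x
    have hs := h (dist x p) ⟨dist_pos.2 hxp, hx⟩ φ
    rw [← hφ] at hs
    simp only [ha, zero_mul] at hs
    exact hs.unique hasSum_zero

lemma SolvesHelmholtz.eq_zero_on_ball (h : SolvesHelmholtz k u (Metric.ball p R)) {ρ : ℝ}
    (hρ : 0 < ρ) (hρR : 2 * ρ ≤ R) (hkρ : |k| * (2 * ρ) ≤ 1) (h0 : ∀ᶠ x in nhds p, u x = 0) :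
    ∀ x ∈ Metric.ball p ρ, u x = 0 := by
  obtain ⟨a, C, -, hmom, hsum, -⟩ := exists_angular_expansion h.1 h.2 hρ hρR hkρ
  obtain ⟨ε, hε, hεu⟩ := Metric.eventually_nhds_iff_ball.1 h0
  refine eq_zero_of_hasSum_zero (k := k) (a := a) (fun n => ?_) h0.self_of_nhds hsum
  have hr : min ε ρ / 2 ∈ Set.Ioo 0 ρ :=
    ⟨by positivity, by have := min_le_right ε ρ; linarith [lt_min hε hρ]⟩
  have h1 := hmom _ hr n
  have h2 : angularMoment u p n (min ε ρ / 2) = 0 := by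
    rw [angularMoment]
    refine (intervalIntegral.integral_congr (g := fun _ => (0 : ℂ)) fun φ _ => ?_).trans
      intervalIntegral.integral_zero
    have : |min ε ρ / 2| < ε := by
      rw [abs_of_pos hr.1]
      have := min_le_left ε ρ
      linarith [lt_min hε hρ]
    simp only [hεu _ (polar_mem_ball p this φ), zero_mul]
  have h3 := (radialMode_bounds k n.natAbs hr.1.le ((mul_le_mul_of_nonneg_left
    (by linarith [hr.2] : min ε ρ / 2 ≤ 2 * ρ) (abs_nonneg k)).trans hkρ)).1
  have h4 : 0 < radialMode k n.natAbs (min ε ρ / 2) :=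
    (half_pos (pow_pos hr.1 _)).trans_le h3
  rw [h2] at h1
  have hpi : (Real.pi : ℂ) ≠ 0 := by exact_mod_cast Real.pi_ne_zero
  have h5 : (radialMode k n.natAbs (min ε ρ / 2) : ℂ) ≠ 0 := by exact_mod_cast h4.ne'
  simpa [hpi, h5] using h1.symm

/-- Unique continuation for the Helmholtz equation. -/
theorem SolvesHelmholtz.eq_zero_of_isPreconnected {A : Set Plane} (h : SolvesHelmholtz k u A)
    (hA : IsOpen A) (hAc : IsPreconnected A) {q : Plane} (hq : q ∈ A)
    (h0 : ∀ᶠ x in nhds q, u x = 0) : ∀ x ∈ A, u x = 0 := by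
  have hsub : A ⊆ {x | ∀ᶠ y in nhds x, u y = 0} := by
    refine hAc.subset_of_closure_inter_subset isOpen_setOfPred_eventually_nhds ⟨q, hq, h0⟩ ?_
    rintro x ⟨hx, hxA⟩
    obtain ⟨R, hR, hRA⟩ := Metric.isOpen_iff.1 hA x hxA
    obtain ⟨ρ, hρ, hρR, hkρ⟩ := exists_small_radius k (half_pos hR)
    obtain ⟨y, hy, hxy⟩ := Metric.mem_closure_iff.1 hx ρ hρ
    have hball : Metric.ball y (R / 2) ⊆ A :=
      (Metric.ball_subset_ball' (by rw [dist_comm]; linarith)).trans hRA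
    have h1 := (h.mono hball).eq_zero_on_ball hρ hρR hkρ hy
    filter_upwards [Metric.isOpen_ball.mem_nhds (Metric.mem_ball.2 hxy)] with z hz using h1 z hz
  exact fun x hx => (hsub hx).self_of_nhds

/-! ### Solutions satisfying boundary conditions on two rays -/

/-- On a segment that leaves `p` in the direction of polar angle `φ`, the function `u` vanishes or
satisfies an impedance condition. -/
def HasRayCondition (u : Plane → ℂ) (p : Plane) (φ : ℝ) : Prop :=
  ∃ δ : ℝ, 0 < δ ∧ ((∀ r ∈ Set.Ioo 0 δ, u (p + r • polarDir φ) = 0) ∨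
    ∃ c : ℂ, ∀ r ∈ Set.Ioo 0 δ,
      fderiv ℝ u (p + r • polarDir φ) (polarNormal φ) = c * u (p + r • polarDir φ))

lemma tsum_natAbs_eq {m : ℕ} (hm : 0 < m) (g : ℤ → ℂ) :
    (∑' n : ℤ, if n.natAbs = m then g n else 0) = g m + g (-m) := by
  have hne : (m : ℤ) ≠ -m := by omega
  rw [tsum_eq_sum (s := {(m : ℤ), -(m : ℤ)}) fun n hn => ?_, Finset.sum_pair hne]
  · simp
  · rw [if_neg]
    simp only [Finset.mem_insert, Finset.mem_singleton] at hn
    omega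

/-- To leading order, the condition on a ray is a Dirichlet or a Neumann condition. -/
lemma HasRayCondition.leading {φ : ℝ} (hray : HasRayCondition u p φ) {ρ : ℝ} (hρ : 0 < ρ)
    (hkρ : |k| * ρ ≤ 1) {a : ℤ → ℂ} {C : ℝ} (hb : ∀ n, ‖a n‖ ≤ C / ρ ^ n.natAbs)
    (h0 : ∀ r ∈ Set.Ioo 0 ρ, ∀ φ : ℝ, HasSum (fun n : ℤ => a n * radialMode k n.natAbs r *
        Complex.exp (Complex.I * n * φ)) (u (p + r • polarDir φ)))
    (h1 : ∀ r ∈ Set.Ioo 0 ρ, ∀ φ : ℝ, HasSum (fun n : ℤ => Complex.I * n * a n *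
        radialMode k n.natAbs r * Complex.exp (Complex.I * n * φ))
        (fderiv ℝ u (p + r • polarDir φ) (r • polarNormal φ)))
    {m : ℕ} (hm : 0 < m) (ham : ∀ n : ℤ, n.natAbs < m → a n = 0) :
    ∃ σ : ℂ, σ ^ 2 = 1 ∧ a m * Complex.exp (Complex.I * m * φ) +
      σ * (a (-m) * Complex.exp (-(Complex.I * m * φ))) = 0 := by
  have hC : 0 ≤ C := by simpa using (norm_nonneg _).trans (hb 0)
  have t0 := tendsto_div_pow_of_hasSum (b := a) (C := C) hρ hkρ
    (fun n => (hb n).trans (le_mul_of_one_le_left (by positivity) (by simp)))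
    ham (φ := φ) (fun r hr => h0 r hr φ)
  have t1 := tendsto_div_pow_of_hasSum (b := fun n => Complex.I * n * a n) (C := C) (m := m) hρ hkρ
    (fun n => by
      rw [norm_mul, norm_mul, Complex.norm_I, one_mul, Complex.norm_intCast, ← Int.cast_abs,
        Int.abs_eq_natAbs, Int.cast_natCast]
      exact mul_le_mul (by linarith) (hb n) (norm_nonneg _) (by positivity))
    (fun n hn => by simp [ham n hn]) (φ := φ) (fun r hr => h1 r hr φ)
  rw [tsum_natAbs_eq hm] at t0 t1
  obtain ⟨δ, hδ, hD | ⟨c, hc⟩⟩ := hray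
  · refine ⟨1, one_pow 2, ?_⟩
    have : Tendsto (fun r : ℝ => u (p + r • polarDir φ) / (r : ℂ) ^ m)
        (nhdsWithin 0 (Set.Ioi 0)) (nhds 0) := by
      refine tendsto_const_nhds.congr' ?_
      filter_upwards [Ioo_mem_nhdsGT hδ] with r hr
      rw [hD r hr, zero_div]
    have := tendsto_nhds_unique t0 this
    push_cast at this
    rw [← this]
    ring_nf
  · refine ⟨-1, by norm_num, ?_⟩
    have : Tendsto (fun r : ℝ => fderiv ℝ u (p + r • polarDir φ) (r • polarNormal φ) / (r : ℂ) ^ m)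
        (nhdsWithin 0 (Set.Ioi 0)) (nhds 0) := by
      have hr0 : Tendsto (fun r : ℝ => (r : ℂ)) (nhdsWithin 0 (Set.Ioi 0)) (nhds 0) := by
        simpa using (Complex.continuous_ofReal.tendsto 0).mono_left
          (nhdsWithin_le_nhds (s := Set.Ioi (0 : ℝ)))
      have h2 := (hr0.const_mul c).mul t0
      rw [mul_zero, zero_mul] at h2
      refine h2.congr' ?_
      filter_upwards [Ioo_mem_nhdsGT hδ] with r hr
      rw [map_smul, hc r hr, Complex.real_smul]
      ring
    have := tendsto_nhds_unique t1 this
    have hm' : (m : ℂ) ≠ 0 := by exact_mod_cast hm.ne'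
    have h3 : Complex.I * m ≠ 0 := mul_ne_zero Complex.I_ne_zero hm'
    refine mul_left_cancel₀ h3 ?_
    push_cast at this
    rw [mul_zero, ← this]
    ring_nf

/-- A solution of the Helmholtz equation that vanishes at a point, and satisfies Dirichlet or
impedance conditions on two segments leaving that point at an angle that is not a rational multiple
of `π`, vanishes: its leading homogeneous part `r ^ m (a e^{i m φ} + b e^{-i m φ})` would satisfy
Dirichlet or Neumann conditions on both segments. -/
theorem SolvesHelmholtz.eq_zero_near_corner (h : SolvesHelmholtz k u (Metric.ball p R))
    (hR : 0 < R) (hp : u p = 0) {φ₁ φ₂ : ℝ}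
    (hirr : ∀ m : ℕ, 0 < m → ∀ j : ℤ, 4 * m * (φ₁ - φ₂) ≠ 2 * Real.pi * j)
    (h₁ : HasRayCondition u p φ₁) (h₂ : HasRayCondition u p φ₂) :
    ∀ᶠ x in nhds p, u x = 0 := by
  obtain ⟨ρ, hρ, hρR, hkρ⟩ := exists_small_radius k hR
  have hkρ' : |k| * ρ ≤ 1 := by nlinarith [abs_nonneg k]
  obtain ⟨a, C, hb, -, hs0, hs1⟩ := exists_angular_expansion h.1 h.2 hρ hρR hkρ
  have hC : 0 ≤ C := by simpa using (norm_nonneg _).trans (hb 0)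
  have ha : ∀ m : ℕ, ∀ n : ℤ, n.natAbs = m → a n = 0 := fun m => by
    induction m using Nat.strong_induction_on with
    | _ m ih =>
      have ham : ∀ n : ℤ, n.natAbs < m → a n = 0 := fun n hn => ih _ hn n rfl
      rcases Nat.eq_zero_or_pos m with rfl | hm
      · have t0 := tendsto_div_pow_of_hasSum (b := a) (C := C) hρ hkρ'
          (fun n => (hb n).trans (le_mul_of_one_le_left (by positivity) (by simp)))
          ham (φ := 0) (fun r hr => hs0 r hr 0)
        have hcont : ContinuousAt (fun r : ℝ => u (p + r • polarDir 0)) 0 := by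
          have hup : ContinuousAt u (p + (0 : ℝ) • polarDir 0) := by
            rw [zero_smul, add_zero]
            exact (hasFDerivAt_of_contDiffOn Metric.isOpen_ball h.1
              (Metric.mem_ball_self hR)).continuousAt
          exact hup.comp (f := fun r : ℝ => p + r • polarDir 0) (hasDerivAt_radial 0 0).continuousAt
        have t1 := hcont.tendsto.mono_left (nhdsWithin_le_nhds (s := Set.Ioi (0 : ℝ)))
        simp only [zero_smul, add_zero, hp] at t1
        simp only [pow_zero, div_one] at t0
        have h2 := tendsto_nhds_unique t0 t1
        rw [tsum_eq_single 0 fun n hn => if_neg (by simpa using hn)] at h2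
        intro n hn
        rw [Int.natAbs_eq_zero.1 hn]
        simpa using h2
      · obtain ⟨σ₁, hσ₁, e₁⟩ := h₁.leading hρ hkρ' hb hs0 hs1 hm ham
        obtain ⟨σ₂, hσ₂, e₂⟩ := h₂.leading hρ hkρ' hb hs0 hs1 hm ham
        -- the two equations give `a m ^ 2 * e^{4 i m φ} = a (-m) ^ 2` for both angles
        have key : ∀ (φ : ℝ) (σ : ℂ), σ ^ 2 = 1 → a m * Complex.exp (Complex.I * m * φ) +
            σ * (a (-m) * Complex.exp (-(Complex.I * m * φ))) = 0 →
            a m ^ 2 * Complex.exp (Complex.I * (4 * m * φ)) = a (-m) ^ 2 := fun φ σ hσ e => by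
          have hx : Complex.exp (Complex.I * (4 * m * φ)) =
              Complex.exp (Complex.I * m * φ) ^ 4 := by
            rw [← Complex.exp_nat_mul]; congr 1; push_cast; ring
          have hy : Complex.exp (Complex.I * m * φ) * Complex.exp (-(Complex.I * m * φ)) = 1 := by
            rw [← Complex.exp_add, add_neg_cancel, Complex.exp_zero]
          rw [hx]
          set X := Complex.exp (Complex.I * m * φ)
          set Y := Complex.exp (-(Complex.I * m * φ))
          have e' : a m * X ^ 2 = -σ * a (-m) := by
            linear_combination X * e - σ * a (-m) * hy
          calc a m ^ 2 * X ^ 4 = (a m * X ^ 2) ^ 2 := by ring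
            _ = a (-m) ^ 2 := by rw [e']; linear_combination a (-m) ^ 2 * hσ
        have k₁ := key φ₁ σ₁ hσ₁ e₁
        have k₂ := key φ₂ σ₂ hσ₂ e₂
        have ham0 : a m = 0 := by
          by_contra hne
          have h3 : Complex.exp (Complex.I * (4 * m * φ₁)) =
              Complex.exp (Complex.I * (4 * m * φ₂)) :=
            mul_left_cancel₀ (pow_ne_zero 2 hne) (k₁.trans k₂.symm)
          obtain ⟨j, hj⟩ := Complex.exp_eq_exp_iff_exists_int.1 h3
          refine hirr m hm j ?_
          have h4 : ((4 * m * (φ₁ - φ₂) : ℝ) : ℂ) = ((2 * Real.pi * j : ℝ) : ℂ) := by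
            push_cast
            refine mul_left_cancel₀ Complex.I_ne_zero ?_
            linear_combination hj
          exact_mod_cast h4
        have ham1 : a (-m) = 0 := by
          rw [ham0] at k₁
          simpa using k₁.symm
        intro n hn
        rcases Int.natAbs_eq n with h5 | h5 <;> rw [hn] at h5 <;> rw [h5] <;> assumption
  filter_upwards [Metric.ball_mem_nhds p hρ] with x hx using
    eq_zero_of_hasSum_zero (k := k) (fun n => ha _ n rfl) hp hs0 x hx

end Expansion

/-! ### Green's formula above a straight line -/

section Green

/-- The coordinates `(t, s) ↦ (t, m t + c + s)` of the plane, in which the line of slope `m` and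
intercept `c` is `{s = 0}`. -/
noncomputable def lineCoords (m c : ℝ) : ℝ × ℝ ≃ₜ Plane where
  toFun q := !₂[q.1, m * q.1 + c + q.2]
  invFun x := (x 0, x 1 - (m * x 0 + c))
  left_inv q := by simp
  right_inv x := by ext i; fin_cases i <;> simp
  continuous_toFun := by fun_prop
  continuous_invFun := by fun_prop

lemma lineCoords_eq (m c t s : ℝ) :
    lineCoords m c (t, s) = t • (stdVec 0 + m • stdVec 1) + (c + s) • stdVec 1 := by
  ext i; fin_cases i <;> simp [lineCoords]
  ring

lemma lineCoords_zero (m c t : ℝ) : lineCoords m c (t, 0) = !₂[t, m * t + c] := by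
  simp [lineCoords]

lemma measurePreserving_lineCoords (m c : ℝ) :
    MeasurePreserving (lineCoords m c) (volume : Measure (ℝ × ℝ)) volume := by
  have h1 : MeasurePreserving (fun q : ℝ × ℝ => (q.1, m * q.1 + c + q.2)) volume volume :=
    (MeasurePreserving.id volume).skew_product (g := fun t s => m * t + c + s) (by fun_prop)
      (Eventually.of_forall fun t => map_add_left_eq_self volume (m * t + c))
  have h2 := (PiLp.volume_preserving_toLp (Fin 2)).comp
    ((volume_preserving_finTwoArrow ℝ).symm.comp h1)
  have h3 : ⇑(lineCoords m c) = WithLp.toLp 2 ∘ ⇑(MeasurableEquiv.finTwoArrow (α := ℝ)).symm ∘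
      fun q : ℝ × ℝ => (q.1, m * q.1 + c + q.2) := by
    funext q
    ext i
    fin_cases i <;> rfl
  rw [h3]
  exact h2

/-- In line coordinates the half plane above the line is `{s > 0}`. -/
lemma setIntegral_upperDomain_line (m c : ℝ) (h : Plane → ℂ) :
    ∫ x in upperDomain (fun t => m * t + c), h x =
      ∫ q in Set.univ ×ˢ Set.Ioi (0 : ℝ), h (lineCoords m c q) := by
  rw [← (measurePreserving_lineCoords m c).setIntegral_preimage_emb
    (lineCoords m c).measurableEmbedding]
  congr 2
  ext q
  simp [upperDomain, lineCoords]

variable {P : Plane → ℂ}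

lemma integrable_lineCoords {h : Plane → ℂ} (hc : Continuous h) (hs : HasCompactSupport h)
    (m c : ℝ) : Integrable (fun q => h (lineCoords m c q)) :=
  (hc.comp (lineCoords m c).continuous).integrable_of_hasCompactSupport
    (hs.comp_homeomorph (lineCoords m c))

lemma hasCompactSupport_lineCoords_left (hs : HasCompactSupport P) (m c s : ℝ) :
    HasCompactSupport fun t => P (lineCoords m c (t, s)) := by
  refine HasCompactSupport.intro
    ((hs.comp_homeomorph (lineCoords m c)).isCompact.image continuous_fst) fun t ht => ?_
  by_contra hne
  exact ht ⟨(t, s), subset_tsupport _ hne, rfl⟩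

lemma hasCompactSupport_lineCoords_right (hs : HasCompactSupport P) (m c t : ℝ) :
    HasCompactSupport fun s => P (lineCoords m c (t, s)) := by
  refine HasCompactSupport.intro
    ((hs.comp_homeomorph (lineCoords m c)).isCompact.image continuous_snd) fun s hs' => ?_
  by_contra hne
  exact hs' ⟨(t, s), subset_tsupport _ hne, rfl⟩

lemma hasDerivAt_lineCoords_left (hP : ContDiff ℝ 1 P) (m c s t : ℝ) :
    HasDerivAt (fun t => P (lineCoords m c (t, s)))
      (partialDeriv 0 P (lineCoords m c (t, s)) + m * partialDeriv 1 P (lineCoords m c (t, s)))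
      t := by
  have h1 : HasDerivAt (fun t => lineCoords m c (t, s)) (stdVec 0 + m • stdVec 1) t := by
    simp only [lineCoords_eq]
    simpa using ((hasDerivAt_id t).smul_const (stdVec 0 + m • stdVec 1)).add_const
      ((c + s) • stdVec 1)
  refine ((hP.differentiable (by norm_num) _).hasFDerivAt.comp_hasDerivAt t h1).congr_deriv ?_
  simp [partialDeriv]

lemma hasDerivAt_lineCoords_right (hP : ContDiff ℝ 1 P) (m c t s : ℝ) :
    HasDerivAt (fun s => P (lineCoords m c (t, s))) (partialDeriv 1 P (lineCoords m c (t, s)))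
      s := by
  have h1 : HasDerivAt (fun s => lineCoords m c (t, s)) (stdVec 1) s := by
    simp only [lineCoords_eq]
    simpa using (((hasDerivAt_id s).const_add c).smul_const (stdVec 1)).const_add
      (t • (stdVec 0 + m • stdVec 1))
  exact (hP.differentiable (by norm_num) _).hasFDerivAt.comp_hasDerivAt s h1

lemma continuous_partialDeriv (hP : ContDiff ℝ 1 P) (i : Fin 2) : Continuous (partialDeriv i P) :=
  (hP.continuous_fderiv (by norm_num)).clm_apply continuous_const

lemma hasCompactSupport_partialDeriv (hs : HasCompactSupport P) (i : Fin 2) :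
    HasCompactSupport (partialDeriv i P) :=
  hs.fderiv_apply ℝ _

/-- The vertical part of the divergence theorem above a line. -/
lemma setIntegral_partialDeriv_one (hP : ContDiff ℝ 1 P) (hs : HasCompactSupport P) (m c : ℝ) :
    ∫ x in upperDomain (fun t => m * t + c), partialDeriv 1 P x =
      -∫ t : ℝ, P !₂[t, m * t + c] := by
  rw [setIntegral_upperDomain_line, Measure.volume_eq_prod, setIntegral_prod _
    (integrable_lineCoords (continuous_partialDeriv hP 1)
      (hasCompactSupport_partialDeriv hs 1) m c).integrableOn, Measure.restrict_univ,
    ← integral_neg]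
  congr 1
  ext t
  have h1 : ContDiff ℝ 1 fun s => P (lineCoords m c (t, s)) := by
    simp only [lineCoords_eq]
    fun_prop
  have h2 := HasCompactSupport.integral_Ioi_deriv_eq h1
    (hasCompactSupport_lineCoords_right hs m c t) 0
  rw [lineCoords_zero] at h2
  rw [← h2]
  congr 1
  ext s
  exact (hasDerivAt_lineCoords_right hP m c t s).deriv.symm

/-- The tangential part of the divergence theorem above a line. -/
lemma setIntegral_partialDeriv_tangential (hP : ContDiff ℝ 1 P) (hs : HasCompactSupport P)
    (m c : ℝ) :
    ∫ x in upperDomain (fun t => m * t + c), (partialDeriv 0 P x + m * partialDeriv 1 P x) = 0 := by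
  have hc : Continuous fun x => partialDeriv 0 P x + m * partialDeriv 1 P x :=
    (continuous_partialDeriv hP 0).add (continuous_const.mul (continuous_partialDeriv hP 1))
  have hs' : HasCompactSupport fun x => partialDeriv 0 P x + m * partialDeriv 1 P x :=
    (hasCompactSupport_partialDeriv hs 0).add
      ((hasCompactSupport_partialDeriv hs 1).mul_left (f := fun _ => (m : ℂ)))
  have hsw : Integrable (fun q : ℝ × ℝ => partialDeriv 0 P (lineCoords m c q.swap) +
      m * partialDeriv 1 P (lineCoords m c q.swap)) (volume.prod volume) :=
    (integrable_lineCoords hc hs' m c).swap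
  rw [setIntegral_upperDomain_line, Measure.volume_eq_prod, ← setIntegral_prod_swap,
    setIntegral_prod _ hsw.integrableOn]
  refine (setIntegral_congr_fun measurableSet_Ioi fun s _ => ?_).trans (integral_zero ℝ ℂ)
  simp only [Prod.swap_prod_mk, Measure.restrict_univ]
  refine integral_eq_zero_of_hasDerivAt_of_integrable (hasDerivAt_lineCoords_left hP m c s) ?_ ?_
  · exact (hc.comp ((lineCoords m c).continuous.comp
      (by fun_prop : Continuous fun t : ℝ => (t, s)))).integrable_of_hasCompactSupport
      (hasCompactSupport_lineCoords_left hs' m c s)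
  · exact (hP.continuous.comp ((lineCoords m c).continuous.comp
      (by fun_prop : Continuous fun t : ℝ => (t, s)))).integrable_of_hasCompactSupport
      (hasCompactSupport_lineCoords_left hs m c s)

/-- The product with a test function `φ` is globally `C¹` even if `v` is so only near the support
of `φ`. -/
lemma contDiff_mul_of_tsupport {φ v : Plane → ℂ} {s : Set Plane} (hs : IsOpen s)
    (hφ : ContDiff ℝ (⊤ : ℕ∞) φ) (hφs : tsupport φ ⊆ s) (hv : ContDiffOn ℝ 1 v s) :
    ContDiff ℝ 1 fun x => φ x * v x := by
  refine contDiff_iff_contDiffAt.2 fun x => ?_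
  by_cases hx : x ∈ tsupport φ
  swap
  · refine (contDiffAt_const (c := (0 : ℂ))).congr_of_eventuallyEq ?_
    filter_upwards [notMem_tsupport_iff_eventuallyEq.1 hx] with y hy
    rw [hy, Pi.zero_apply, zero_mul]
  have hx' : x ∈ s := hφs hx
  exact ((hφ.of_le (by exact_mod_cast le_top)).contDiffAt).mul (hv.contDiffAt (hs.mem_nhds hx'))

lemma contDiffOn_partialDeriv {u : Plane → ℂ} {s : Set Plane} (hs : IsOpen s)
    (hu : ContDiffOn ℝ 2 u s) (i : Fin 2) : ContDiffOn ℝ 1 (partialDeriv i u) s :=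
  (contDiffOn_fderiv hs hu).clm_apply contDiffOn_const

lemma laplacian_eq_partialDeriv {u : Plane → ℂ} {s : Set Plane} (hs : IsOpen s)
    (hu : ContDiffOn ℝ 2 u s) {x : Plane} (hx : x ∈ s) :
    Laplacian.laplacian u x =
      partialDeriv 0 (partialDeriv 0 u) x + partialDeriv 1 (partialDeriv 1 u) x := by
  have h : ∀ i, partialDeriv i (partialDeriv i u) x =
      fderiv ℝ (fderiv ℝ u) x (stdVec i) (stdVec i) := fun i => by
    have h1 := (hasFDerivAt_fderiv_of_contDiffOn hs hu hx).clm_apply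
      (hasFDerivAt_const (stdVec i) x)
    have h2 : fderiv ℝ (partialDeriv i u) x = _ := h1.fderiv
    rw [partialDeriv, h2]
    simp
  rw [h, h, InnerProductSpace.laplacian_eq_iteratedFDeriv_orthonormalBasis u
    (EuclideanSpace.basisFun (Fin 2) ℝ)]
  simp [iteratedFDeriv_two_apply, stdVec]

/-- Green's formula above a line, for a solution of the Helmholtz equation near the support of the
test function. -/
lemma SolvesHelmholtz.green {k : ℝ} {u φ : Plane → ℂ} {s : Set Plane} (hs : IsOpen s)
    (hu : SolvesHelmholtz k u s) (hφ : ContDiff ℝ (⊤ : ℕ∞) φ) (hφc : HasCompactSupport φ)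
    (hφs : tsupport φ ⊆ s) (m c : ℝ) :
    ∫ x in upperDomain (fun t => m * t + c),
        ((∑ i : Fin 2, partialDeriv i u x * partialDeriv i φ x) - (k : ℂ) ^ 2 * u x * φ x) =
      ∫ t : ℝ, φ !₂[t, m * t + c] * (m * partialDeriv 0 u !₂[t, m * t + c] -
        partialDeriv 1 u !₂[t, m * t + c]) := by
  set P : Fin 2 → Plane → ℂ := fun i x => φ x * partialDeriv i u x
  have hP : ∀ i, ContDiff ℝ 1 (P i) := fun i =>
    contDiff_mul_of_tsupport hs hφ hφs (contDiffOn_partialDeriv hs hu.1 i)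
  have hPs : ∀ i, HasCompactSupport (P i) := fun i => hφc.mul_right
  have key : ∀ x, (∑ i : Fin 2, partialDeriv i u x * partialDeriv i φ x) -
      (k : ℂ) ^ 2 * u x * φ x = (partialDeriv 0 (P 0) x + m * partialDeriv 1 (P 0) x) +
        (partialDeriv 1 (P 1) x - m * partialDeriv 1 (P 0) x) := fun x => by
    rw [Fin.sum_univ_two]
    by_cases hx : x ∈ tsupport φ
    · have hP' : ∀ i j, partialDeriv j (P i) x =
          φ x * partialDeriv j (partialDeriv i u) x +
            partialDeriv i u x * partialDeriv j φ x := fun i j => by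
        have h1 : HasFDerivAt φ (fderiv ℝ φ x) x :=
          (hφ.differentiable (by simp) x).hasFDerivAt
        have h2 : HasFDerivAt (partialDeriv i u) (fderiv ℝ (partialDeriv i u) x) x :=
          (((contDiffOn_partialDeriv hs hu.1 i).differentiableOn (by norm_num)).differentiableAt
            (hs.mem_nhds (hφs hx))).hasFDerivAt
        have h3 : fderiv ℝ (P i) x = _ := (h1.mul h2).fderiv
        rw [partialDeriv, h3]
        simp [partialDeriv]
      have h := hu.2 x (hφs hx)
      rw [laplacian_eq_partialDeriv hs hu.1 (hφs hx)] at h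
      simp only [hP']
      linear_combination (-φ x) * h
    · have h1 : φ =ᶠ[nhds x] 0 := notMem_tsupport_iff_eventuallyEq.1 hx
      have h2 : ∀ i, P i =ᶠ[nhds x] 0 := fun i => by
        filter_upwards [h1] with y hy
        simp [P, hy]
      have h3 : ∀ j, partialDeriv j φ x = 0 := fun j => by
        simp [partialDeriv, h1.fderiv_eq]
      have h4 : ∀ i j, partialDeriv j (P i) x = 0 := fun i j => by
        simp [partialDeriv, (h2 i).fderiv_eq]
      simp [h3, h4, h1.self_of_nhds]
  have hint : ∀ i j, Integrable (partialDeriv j (P i)) := fun i j =>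
    (continuous_partialDeriv (hP i) j).integrable_of_hasCompactSupport
      (hasCompactSupport_partialDeriv (hPs i) j)
  have htr : ∀ i, Integrable fun t : ℝ => P i !₂[t, m * t + c] := fun i => by
    have h1 := (hP i).continuous.comp ((lineCoords m c).continuous.comp
      (by fun_prop : Continuous fun t : ℝ => (t, (0 : ℝ))))
    have h2 := h1.integrable_of_hasCompactSupport (μ := volume)
      (hasCompactSupport_lineCoords_left (hPs i) m c 0)
    simpa only [Function.comp_def, lineCoords_zero] using h2
  simp only [key]
  have i1 : Integrable fun x => partialDeriv 0 (P 0) x + m * partialDeriv 1 (P 0) x :=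
    (hint 0 0).add ((hint 0 1).const_mul _)
  have i2 : Integrable fun x => partialDeriv 1 (P 1) x - m * partialDeriv 1 (P 0) x :=
    (hint 1 1).sub ((hint 0 1).const_mul _)
  rw [integral_add i1.integrableOn i2.integrableOn,
    setIntegral_partialDeriv_tangential (hP 0) (hPs 0),
    integral_sub (hint 1 1).integrableOn ((hint 0 1).const_mul _).integrableOn,
    integral_const_mul, setIntegral_partialDeriv_one (hP 1) (hPs 1),
    setIntegral_partialDeriv_one (hP 0) (hPs 0)]
  rw [zero_add, mul_neg, sub_neg_eq_add, neg_add_eq_sub, ← integral_const_mul,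
    ← integral_sub ((htr 0).const_mul _) (htr 1)]
  congr 1
  ext t
  simp only [P]
  ring

end Green

/-! ### The boundary condition on a linear piece -/

section Boundary

variable {f : ℝ → ℝ} {η : ℝ → OnePoint ℂ} {k : ℝ} {u v : Plane → ℂ} {w : ℝ → ℂ} {p : Plane}
  {R a b m c : ℝ} {e : OnePoint ℂ}

lemma continuous_vec {g h : ℝ → ℝ} (hg : Continuous g) (hh : Continuous h) :
    Continuous fun t => (!₂[g t, h t] : Plane) := by
  have : (fun t => (!₂[g t, h t] : Plane)) = fun t => g t • stdVec 0 + h t • stdVec 1 := by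
    funext t; ext i; fin_cases i <;> simp
  rw [this]
  fun_prop

/-- Where a field extends continuously across the curve, its trace is given by the extension. -/
lemma IsTrace.ae_eq_extension (hw : IsTrace f u w) (hf : Continuous f)
    (hu : ContinuousOn u (upperDomain f)) (hv : ContinuousOn v (Metric.ball p R))
    (huv : ∀ x ∈ upperDomain f ∩ Metric.ball p R, u x = v x)
    (hball : ∀ t ∈ Set.Ioo a b, !₂[t, f t] ∈ Metric.ball p R) :
    ∀ᵐ t : ℝ, t ∈ Set.Ioo a b → w t = v !₂[t, f t] := by
  obtain ⟨hmem, hlim⟩ := hw (max |a| |b|)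
  set s : ℕ → ℝ := fun n => 1 / ((n : ℝ) + 1) with hs
  have hspos : ∀ n, 0 < s n := fun n => Nat.one_div_pos_of_nat
  have hs0 : Tendsto s atTop (nhds 0) := tendsto_one_div_add_atTop_nhds_zero_nat
  have hsw : Tendsto s atTop (nhdsWithin 0 (Set.Ioi 0)) :=
    tendsto_nhdsWithin_iff.2 ⟨hs0, Eventually.of_forall hspos⟩
  have hmeas : ∀ n, AEStronglyMeasurable (fun t : ℝ => u !₂[t, f t + s n])
      (volume.restrict (Set.Icc (-max |a| |b|) (max |a| |b|))) := fun n => by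
    have hc : Continuous fun t : ℝ => u !₂[t, f t + s n] :=
      hu.comp_continuous (continuous_vec continuous_id (hf.add continuous_const)) fun t => by
        have := hspos n
        simpa [upperDomain] using this
    exact hc.aestronglyMeasurable
  obtain ⟨ns, hns, hae⟩ := (tendstoInMeasure_of_tendsto_eLpNorm (by norm_num) hmeas
    hmem.aestronglyMeasurable (hlim.comp hsw)).exists_seq_tendsto_ae
  have hae' := (ae_restrict_iff' measurableSet_Icc).1 hae
  filter_upwards [hae'] with t ht htI
  have htR : t ∈ Set.Icc (-max |a| |b|) (max |a| |b|) :=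
    ⟨by linarith [neg_abs_le a, le_max_left |a| |b|, htI.1],
      by linarith [le_abs_self b, le_max_right |a| |b|, htI.2]⟩
  have hsub : Tendsto (fun i => s (ns i)) atTop (nhds 0) := hs0.comp hns.tendsto_atTop
  have hpt : Tendsto (fun i => (!₂[t, f t + s (ns i)] : Plane)) atTop (nhds !₂[t, f t]) := by
    have h1 := (continuous_vec (g := fun _ => t) (h := fun y => f t + y) continuous_const
      (continuous_const.add continuous_id)).tendsto 0
    simp only [add_zero] at h1
    exact h1.comp hsub
  have hv' := ((hv.continuousAt (Metric.isOpen_ball.mem_nhds (hball t htI))).tendsto).comp hpt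
  refine tendsto_nhds_unique (ht htR) (hv'.congr' ?_)
  filter_upwards [hpt.eventually (Metric.isOpen_ball.mem_nhds (hball t htI))] with i hi
  refine (huv _ ⟨?_, hi⟩).symm
  have := hspos (ns i)
  simpa [upperDomain] using this

/-- The boundary condition with parameter `e` at a point `x` of a line of slope `m`, for a function
that is smooth across the line: `v` vanishes if `e = ∞`, and otherwise
`∂₂v - m ∂₁v + e √(1 + m²) v = 0`, the normal to the line being a multiple of `(-m, 1)`. -/
def PointwiseCondition (e : OnePoint ℂ) (m : ℝ) (v : Plane → ℂ) (x : Plane) : Prop :=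
  (e = OnePoint.infty → v x = 0) ∧
  (e ≠ OnePoint.infty → partialDeriv 1 v x - m * partialDeriv 0 v x +
    finiteValue e * (Real.sqrt (1 + m ^ 2) : ℂ) * v x = 0)

/-- The weak formulation of the boundary condition over a linear piece of the curve, tested with
functions supported near the piece, in terms of an extension of the field across the piece. -/
lemma SatisfiesBoundaryCondition.integral_eq
    (hbc : SatisfiesBoundaryCondition f η k u w) (hv : SolvesHelmholtz k v (Metric.ball p R))
    (hopen : IsOpen (upperDomain f))
    (huv : ∀ x ∈ upperDomain f ∩ Metric.ball p R, u x = v x)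
    (hline : ∀ t ∈ Set.Ioo a b, f t = m * t + c ∧ η t = e) (he : e ≠ OnePoint.infty)
    (hwv : ∀ᵐ t : ℝ, t ∈ Set.Ioo a b → w t = v !₂[t, f t]) {φ : Plane → ℂ}
    (hφ : ContDiff ℝ (⊤ : ℕ∞) φ) (hφc : HasCompactSupport φ) (hφs : tsupport φ ⊆ Metric.ball p R)
    (hφI : ∀ x ∈ tsupport φ, x 0 ∈ Set.Ioo a b) :
    ∫ t : ℝ, φ !₂[t, m * t + c] * (m * partialDeriv 0 v !₂[t, m * t + c] -
        partialDeriv 1 v !₂[t, m * t + c]) =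
      ∫ t : ℝ, φ !₂[t, m * t + c] *
        (finiteValue e * (Real.sqrt (1 + m ^ 2) : ℂ) * v !₂[t, m * t + c]) := by
  have hφ0 : ∀ t y, t ∉ Set.Ioo a b → φ !₂[t, y] = 0 := fun t y ht => by
    by_contra hne
    exact ht (by simpa using hφI _ (subset_tsupport φ hne))
  have h := hbc.2 φ hφ hφc (Eventually.of_forall fun t ht => hφ0 t _ fun htI =>
    he ((hline t htI).2.symm.trans ht))
  rw [← hv.green Metric.isOpen_ball hφ hφc hφs]
  have hmeasf := hopen.measurableSet
  have hmeasl : MeasurableSet (upperDomain fun t => m * t + c) := by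
    refine (isOpen_lt ?_ ?_).measurableSet <;> fun_prop
  have h1 : ∫ x in upperDomain f,
        ((∑ i : Fin 2, partialDeriv i u x * partialDeriv i φ x) - (k : ℂ) ^ 2 * u x * φ x) =
      ∫ x in upperDomain (fun t => m * t + c),
        ((∑ i : Fin 2, partialDeriv i v x * partialDeriv i φ x) - (k : ℂ) ^ 2 * v x * φ x) := by
    rw [← integral_indicator hmeasf, ← integral_indicator hmeasl]
    congr 1
    funext x
    by_cases hx : x ∈ tsupport φ
    · have hfx := (hline _ (hφI x hx)).1
      by_cases hxf : x ∈ upperDomain f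
      · have hxl : x ∈ upperDomain fun t => m * t + c := by
          rw [upperDomain, Set.mem_ofPred_eq] at hxf ⊢
          rwa [← hfx]
        have huv' : u =ᶠ[nhds x] v := by
          filter_upwards [(hopen.inter Metric.isOpen_ball).mem_nhds ⟨hxf, hφs hx⟩] with y hy
            using huv y hy
        rw [Set.indicator_of_mem hxf, Set.indicator_of_mem hxl]
        simp only [partialDeriv, huv'.fderiv_eq, huv'.self_of_nhds]
      · have hxl : x ∉ upperDomain fun t => m * t + c := by
          rw [upperDomain, Set.mem_ofPred_eq] at hxf ⊢
          rwa [← hfx]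
        rw [Set.indicator_of_notMem hxf, Set.indicator_of_notMem hxl]
    · have h1 : φ =ᶠ[nhds x] 0 := notMem_tsupport_iff_eventuallyEq.1 hx
      have h3 : ∀ j, partialDeriv j φ x = 0 := fun j => by
        simp [partialDeriv, h1.fderiv_eq]
      simp [Set.indicator, h3, h1.self_of_nhds]
  rw [← h1, h]
  refine integral_congr_ae ?_
  filter_upwards [hwv] with t ht
  by_cases htI : t ∈ Set.Ioo a b
  · have hft : f =ᶠ[nhds t] fun t => m * t + c := by
      filter_upwards [isOpen_Ioo.mem_nhds htI] with s hs using (hline s hs).1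
    have hd : deriv f t = m := by
      rw [hft.deriv_eq]
      simp
    rw [ht htI, hd, (hline t htI).1, (hline t htI).2]
    ring
  · rw [hφ0 t _ htI, hφ0 t _ htI]
    ring

/-- The variational boundary condition holds pointwise on a linear piece of the curve across which
the field extends to a solution of the Helmholtz equation. -/
theorem SatisfiesBoundaryCondition.pointwise (hf : Continuous f)
    (hu : ContinuousOn u (upperDomain f)) (hw : IsTrace f u w)
    (hbc : SatisfiesBoundaryCondition f η k u w) (hR : 0 < R)
    (hv : SolvesHelmholtz k v (Metric.ball p R)) (hopen : IsOpen (upperDomain f))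
    (huv : ∀ x ∈ upperDomain f ∩ Metric.ball p R, u x = v x)
    (hline : ∀ t ∈ Set.Ioo a b, f t = m * t + c ∧ η t = e)
    (hball : ∀ t ∈ Set.Ioo a b, !₂[t, m * t + c] ∈ Metric.ball p (R / 2)) :
    ∀ t ∈ Set.Ioo a b, PointwiseCondition e m v !₂[t, m * t + c] := by
  have hballR : ∀ t ∈ Set.Ioo a b, !₂[t, m * t + c] ∈ Metric.ball p R := fun t ht =>
    Metric.ball_subset_ball (by linarith) (hball t ht)
  have hwv := hw.ae_eq_extension hf hu hv.1.continuousOn huv (a := a) (b := b)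
    fun t ht => by rw [(hline t ht).1]; exact hballR t ht
  have hcl : Continuous fun t : ℝ => (!₂[t, m * t + c] : Plane) :=
    continuous_vec continuous_id (by fun_prop)
  have hcv : ∀ {g : Plane → ℂ}, ContinuousOn g (Metric.ball p R) →
      ContinuousOn (fun t : ℝ => g !₂[t, m * t + c]) (Set.Ioo a b) := fun hg =>
    hg.comp hcl.continuousOn hballR
  -- a continuous function that vanishes almost everywhere on an open interval vanishes there
  have hae : ∀ {g : ℝ → ℂ}, ContinuousOn g (Set.Ioo a b) →
      (∀ᵐ t : ℝ, t ∈ Set.Ioo a b → g t = 0) → ∀ t ∈ Set.Ioo a b, g t = 0 := fun {g} hg h0 =>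
    Measure.eqOn_open_of_ae_eq (μ := volume) (g := fun _ => (0 : ℂ))
      ((ae_restrict_iff' measurableSet_Ioo).2 h0) isOpen_Ioo hg continuousOn_const
  by_cases he : e = OnePoint.infty
  · have h0 : ∀ t ∈ Set.Ioo a b, v !₂[t, m * t + c] = 0 := by
      refine hae (hcv hv.1.continuousOn) ?_
      filter_upwards [hwv, hbc.1] with t h1 h2 ht
      rw [← (hline t ht).1, ← h1 ht]
      exact h2 ((hline t ht).2.trans he)
    exact fun t ht => ⟨fun _ => h0 t ht, fun h => absurd he h⟩
  set lam : ℂ := finiteValue e * (Real.sqrt (1 + m ^ 2) : ℂ) with hlam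
  set H : Plane → ℂ := fun x => (m * partialDeriv 0 v x - partialDeriv 1 v x) - lam * v x with hH
  have hHc : ContinuousOn H (Metric.ball p R) :=
    ((continuousOn_const.mul
      (contDiffOn_partialDeriv Metric.isOpen_ball hv.1 0).continuousOn).sub
      (contDiffOn_partialDeriv Metric.isOpen_ball hv.1 1).continuousOn).sub
      (continuousOn_const.mul hv.1.continuousOn)
  have hH0 : ∀ t ∈ Set.Ioo a b, H !₂[t, m * t + c] = 0 := by
    refine hae (hcv hHc) ?_
    refine isOpen_Ioo.ae_eq_zero_of_integral_contDiff_smul_eq_zero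
      ((hcv hHc).locallyIntegrableOn measurableSet_Ioo) fun g hg hgc hgI => ?_
    -- a test function of the abscissa, cut off by a function that is `1` along the linear piece
    let χ : ContDiffBump p := ⟨R / 2, 3 * R / 4, by linarith, by linarith⟩
    set φ : Plane → ℂ := fun x => (g (x 0) : ℂ) * (χ x : ℂ) with hφdef
    have hx0 : Continuous fun x : Plane => x 0 := by fun_prop
    have hφ : ContDiff ℝ (⊤ : ℕ∞) φ := by
      have h1 : ContDiff ℝ (⊤ : ℕ∞) fun x : Plane => g (x 0) := hg.comp (by fun_prop)
      have h2 : ContDiff ℝ (⊤ : ℕ∞) χ := χ.contDiff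
      exact (Complex.ofRealCLM.contDiff.comp h1).mul (Complex.ofRealCLM.contDiff.comp h2)
    have hsupp : tsupport φ ⊆ {x | x 0 ∈ tsupport g} ∩ Metric.closedBall p (3 * R / 4) := by
      refine closure_minimal (fun x hx => ?_)
        (((isClosed_tsupport g).preimage hx0).inter Metric.isClosed_closedBall)
      rw [Function.mem_support, hφdef] at hx
      constructor
      · refine subset_tsupport g fun h => hx ?_
        simp [h]
      · have : x ∈ tsupport χ := subset_tsupport χ fun h => hx (by simp [h])
        rwa [χ.tsupport_eq] at this
    have hφc : HasCompactSupport φ :=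
      (isCompact_closedBall p (3 * R / 4)).of_isClosed_subset (isClosed_tsupport φ)
        fun x hx => (hsupp hx).2
    have hφs : tsupport φ ⊆ Metric.ball p R := fun x hx =>
      Metric.closedBall_subset_ball (by linarith) (hsupp hx).2
    have key := hbc.integral_eq hv hopen huv hline he hwv hφ hφc hφs
      fun x hx => hgI (hsupp hx).1
    have hint : ∀ {h : Plane → ℂ}, ContDiffOn ℝ 1 h (Metric.ball p R) →
        Integrable fun t : ℝ => φ !₂[t, m * t + c] * h !₂[t, m * t + c] := fun {h} hh => by
      have h1 := (contDiff_mul_of_tsupport Metric.isOpen_ball hφ hφs hh).continuous.comp hcl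
      refine h1.integrable_of_hasCompactSupport ?_
      have := hasCompactSupport_lineCoords_left (P := fun x => φ x * h x) hφc.mul_right m c 0
      simp only [lineCoords_zero] at this
      exact this
    have hv1 : ContDiffOn ℝ 1 v (Metric.ball p R) := hv.1.of_le (by norm_num)
    have i1 := hint (((contDiffOn_const (c := (m : ℂ))).mul
      (contDiffOn_partialDeriv Metric.isOpen_ball hv.1 0)).sub
      (contDiffOn_partialDeriv Metric.isOpen_ball hv.1 1))
    have i2 := hint ((contDiffOn_const (c := lam)).mul hv1)
    have hsub := integral_sub i1 i2
    rw [key, sub_self] at hsub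
    rw [← hsub]
    congr 1
    funext t
    by_cases ht : t ∈ Set.Ioo a b
    · have h1 : χ !₂[t, m * t + c] = 1 :=
        χ.one_of_mem_closedBall (Metric.ball_subset_closedBall (hball t ht))
      simp [hφdef, hH, h1]
      ring
    · have h1 : g t = 0 := by
        by_contra hne
        exact ht (hgI (subset_tsupport g hne))
      simp [hφdef, h1]
  intro t ht
  refine ⟨fun h => absurd h he, fun _ => ?_⟩
  have h1 := hH0 t ht
  simp only [hH] at h1
  linear_combination -h1

end Boundary

/-! ### Rayleigh expansions -/

section Rayleigh

variable {k θ : ℝ}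

lemma integral_exp_int_period (j : ℤ) :
    ∫ t in (0 : ℝ)..2 * Real.pi, Complex.exp (Complex.I * j * t) =
      if j = 0 then 2 * (Real.pi : ℂ) else 0 := by
  split_ifs with h
  · simp [h]
  · have hj : Complex.I * j ≠ 0 := mul_ne_zero Complex.I_ne_zero (by exact_mod_cast h)
    rw [integral_exp_mul_complex hj]
    have : Complex.exp (Complex.I * j * ((2 * Real.pi : ℝ) : ℂ)) = 1 := by
      rw [Complex.exp_eq_one_iff]
      exact ⟨j, by push_cast; ring⟩
    rw [this]
    simp

lemma rayleighMode_vec (n : ℤ) (t h : ℝ) :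
    rayleighMode k θ n !₂[t, h] = Complex.exp (Complex.I * (alphaMode k θ n : ℂ) * t) *
      Complex.exp (Complex.I * betaMode k θ n * h) := by
  rw [← Complex.exp_add, rayleighMode]
  congr 1
  simp
  ring

lemma norm_exp_I_mul_ofReal (x : ℝ) (t : ℝ) : ‖Complex.exp (Complex.I * (x : ℂ) * t)‖ = 1 := by
  rw [show Complex.I * (x : ℂ) * t = ((x * t : ℝ) : ℂ) * Complex.I by push_cast; ring,
    Complex.norm_exp_ofReal_mul_I]

/-- The coefficients of a Rayleigh series are Fourier coefficients on horizontal lines. -/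
lemma integral_rayleigh {c : ℤ → ℂ} {v : Plane → ℂ} {h : ℝ}
    (hv : ∀ t : ℝ, HasSum (fun n : ℤ => c n * rayleighMode k θ n !₂[t, h]) (v !₂[t, h])) (m : ℤ) :
    ∫ t in (0 : ℝ)..2 * Real.pi, v !₂[t, h] * Complex.exp (-(Complex.I * alphaMode k θ m * t)) =
      2 * Real.pi * (c m * Complex.exp (Complex.I * betaMode k θ m * h)) := by
  have hterm : ∀ (n : ℤ) (t : ℝ), c n * rayleighMode k θ n !₂[t, h] *
      Complex.exp (-(Complex.I * alphaMode k θ m * t)) =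
      c n * Complex.exp (Complex.I * betaMode k θ n * h) *
        Complex.exp (Complex.I * ((n - m : ℤ) : ℂ) * t) := fun n t => by
    have : Complex.exp (Complex.I * (alphaMode k θ n : ℂ) * t) *
        Complex.exp (-(Complex.I * alphaMode k θ m * t)) =
        Complex.exp (Complex.I * ((n - m : ℤ) : ℂ) * t) := by
      rw [← Complex.exp_add]
      congr 1
      simp only [alphaMode]
      push_cast
      ring
    rw [rayleighMode_vec, ← this]
    ring
  have hnorm : ∀ n : ℤ, ‖c n * Complex.exp (Complex.I * betaMode k θ n * h)‖ =
      ‖c n * rayleighMode k θ n !₂[0, h]‖ := fun n => by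
    rw [rayleighMode_vec]; simp
  have hsum : Summable fun n : ℤ => ‖c n * Complex.exp (Complex.I * betaMode k θ n * h)‖ := by
    simp only [hnorm]
    exact (hv 0).summable.norm
  have hE : ∀ (j : ℤ) (t : ℝ), ‖Complex.exp (Complex.I * (j : ℂ) * t)‖ = 1 := fun j t => by
    simpa using norm_exp_I_mul_ofReal (j : ℝ) t
  have h1 := intervalIntegral.hasSum_integral_of_dominated_convergence
    (a := 0) (b := 2 * Real.pi) (μ := volume)
    (F := fun (n : ℤ) (t : ℝ) => c n * Complex.exp (Complex.I * betaMode k θ n * h) *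
        Complex.exp (Complex.I * ((n - m : ℤ) : ℂ) * t))
    (f := fun t => v !₂[t, h] * Complex.exp (-(Complex.I * alphaMode k θ m * t)))
    (fun n _ => ‖c n * Complex.exp (Complex.I * betaMode k θ n * h)‖)
    (fun n => by
      refine Continuous.aestronglyMeasurable ?_
      fun_prop)
    (fun n => Eventually.of_forall fun t _ => by rw [norm_mul, hE, mul_one])
    (Eventually.of_forall fun t _ => hsum) intervalIntegrable_const
    (Eventually.of_forall fun t _ => by
      simp only [← hterm]
      exact (hv t).mul_right _)
  simp only [intervalIntegral.integral_const_mul, integral_exp_int_period] at h1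
  refine h1.unique ?_
  convert hasSum_single m fun n hn => ?_ using 1
  · simp only [sub_self, if_true]
    ring
  · rw [if_neg (sub_ne_zero.2 hn), mul_zero]

lemma incidentWave_vec (t h : ℝ) :
    incidentWave k θ !₂[t, h] = Complex.exp (Complex.I * ((k * Real.sin θ : ℝ) : ℂ) * t) *
      Complex.exp (-(Complex.I * ((k * Real.cos θ : ℝ) : ℂ) * h)) := by
  rw [← Complex.exp_add, incidentWave]
  congr 1
  simp [incidentDirection, PiLp.inner_apply, Fin.sum_univ_two]
  ring

lemma integral_incidentWave (θ' : ℝ) (m j : ℤ) (h : ℝ)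
    (hj : k * Real.sin θ - alphaMode k θ' m = j) :
    ∫ t in (0 : ℝ)..2 * Real.pi,
      incidentWave k θ !₂[t, h] * Complex.exp (-(Complex.I * alphaMode k θ' m * t)) =
      (if j = 0 then 2 * (Real.pi : ℂ) else 0) *
        Complex.exp (-(Complex.I * ((k * Real.cos θ : ℝ) : ℂ) * h)) := by
  rw [← integral_exp_int_period, ← intervalIntegral.integral_mul_const]
  congr 1
  funext t
  have hj' : ((k * Real.sin θ : ℝ) : ℂ) - alphaMode k θ' m = j := by
    rw [← Complex.ofReal_sub, hj]
    simp
  have : Complex.exp (Complex.I * ((k * Real.sin θ : ℝ) : ℂ) * t) *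
      Complex.exp (-(Complex.I * alphaMode k θ' m * t)) = Complex.exp (Complex.I * j * t) := by
    rw [← Complex.exp_add, ← hj']
    congr 1
    ring
  rw [incidentWave_vec, ← this]
  ring

lemma continuous_incidentWave_vec (h : ℝ) : Continuous fun t : ℝ => incidentWave k θ !₂[t, h] := by
  simp only [incidentWave_vec]
  fun_prop

/-- Two Rayleigh series with the same values on a period of a horizontal line are equal. -/
lemma rayleigh_coeff_unique {c d : ℤ → ℂ} {v w : Plane → ℂ} {h : ℝ}
    (hv : ∀ t : ℝ, HasSum (fun n : ℤ => c n * rayleighMode k θ n !₂[t, h]) (v !₂[t, h]))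
    (hw : ∀ t : ℝ, HasSum (fun n : ℤ => d n * rayleighMode k θ n !₂[t, h]) (w !₂[t, h]))
    (hvw : ∀ t ∈ Set.Icc 0 (2 * Real.pi), v !₂[t, h] = w !₂[t, h]) : c = d := by
  funext m
  have h1 := integral_rayleigh hv m
  rw [intervalIntegral.integral_congr (g := fun t =>
    w !₂[t, h] * Complex.exp (-(Complex.I * alphaMode k θ m * t))) fun t ht => by
      rw [Set.uIcc_of_le (by positivity)] at ht
      simp only [hvw t ht], integral_rayleigh hw m] at h1
  have hpi : (2 * Real.pi : ℂ) ≠ 0 := by exact_mod_cast (by positivity : (2 * Real.pi) ≠ 0)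
  exact (mul_right_cancel₀ (Complex.exp_ne_zero _) (mul_left_cancel₀ hpi h1)).symm

lemma plane_eta (x : Plane) : !₂[x 0, x 1] = x := by
  ext i; fin_cases i <;> simp

variable {f f₁ f₂ : ℝ → ℝ} {η η₁ η₂ : ℝ → OnePoint ℂ} {u u₁ u₂ : Plane → ℂ}

/-- Total fields that agree on a period of a horizontal line above the gratings agree above it. -/
theorem IsTotalField.eq_above (h₁ : IsTotalField f₁ η₁ k θ u₁) (h₂ : IsTotalField f₂ η₂ k θ u₂)
    {b : ℝ} (hb₁ : ∀ t, f₁ t < b) (hb₂ : ∀ t, f₂ t < b)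
    (hmeas : ∀ t ∈ Set.Icc 0 (2 * Real.pi), u₁ !₂[t, b] = u₂ !₂[t, b]) {x : Plane} (hx : b ≤ x 1) :
    u₁ x = u₂ x := by
  obtain ⟨c, hc⟩ := h₁.rayleigh
  obtain ⟨d, hd⟩ := h₂.rayleigh
  have hcd : c = d := rayleigh_coeff_unique (h := b)
    (v := fun x => u₁ x - incidentWave k θ x) (w := fun x => u₂ x - incidentWave k θ x)
    (fun t => hc _ (by simpa using hb₁)) (fun t => hd _ (by simpa using hb₂))
    fun t ht => by simp only [hmeas t ht]
  rw [hcd] at hc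
  exact sub_left_injective ((hc x fun t => (hb₁ t).trans_le hx).unique
    (hd x fun t => (hb₂ t).trans_le hx))

/-- The Fourier coefficients of a total field on a horizontal line above the grating. -/
lemma IsTotalField.exists_integral_eq (hu : IsTotalField f η k θ u) :
    ∃ c : ℤ → ℂ, ∀ h, (∀ t, f t < h) → ∀ (θ' : ℝ) (m j : ℤ),
      alphaMode k θ' j = alphaMode k θ m →
      ∫ t in (0 : ℝ)..2 * Real.pi, u !₂[t, h] * Complex.exp (-(Complex.I * alphaMode k θ' j * t)) =
        2 * Real.pi * (c m * Complex.exp (Complex.I * betaMode k θ m * h)) +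
        (if m = 0 then 2 * (Real.pi : ℂ) else 0) *
          Complex.exp (-(Complex.I * ((k * Real.cos θ : ℝ) : ℂ) * h)) := by
  obtain ⟨c, hc⟩ := hu.rayleigh
  refine ⟨c, fun h hh θ' m j hj => ?_⟩
  rw [hj]
  have h1 := integral_rayleigh (v := fun x => u x - incidentWave k θ x) (h := h)
    (fun t => hc _ (by simpa using hh)) m
  have h2 := integral_incidentWave (k := k) (θ := θ) θ m (-m) h (by simp [alphaMode])
  simp only [neg_eq_zero] at h2
  have hcont : Continuous fun t : ℝ => u !₂[t, h] :=
    hu.contDiffOn.continuousOn.comp_continuous (continuous_vec continuous_id continuous_const)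
      fun t => by simpa [upperDomain] using hh t
  have hinc := continuous_incidentWave_vec (k := k) (θ := θ) h
  have hexp : Continuous fun t : ℝ => Complex.exp (-(Complex.I * alphaMode k θ m * t)) := by
    fun_prop
  have i1 : IntervalIntegrable (fun t : ℝ => (u !₂[t, h] - incidentWave k θ !₂[t, h]) *
      Complex.exp (-(Complex.I * alphaMode k θ m * t))) volume 0 (2 * Real.pi) :=
    ((hcont.sub hinc).mul hexp).intervalIntegrable _ _
  have i2 : IntervalIntegrable (fun t : ℝ => incidentWave k θ !₂[t, h] *
      Complex.exp (-(Complex.I * alphaMode k θ m * t))) volume 0 (2 * Real.pi) :=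
    (hinc.mul hexp).intervalIntegrable _ _
  rw [← h1, ← h2, ← intervalIntegral.integral_add i1 i2]
  congr 1
  funext t
  ring

lemma betaMode_zero (hk : 0 < k) (hθ : 0 < Real.cos θ) :
    betaMode k θ 0 = ((k * Real.cos θ : ℝ) : ℂ) := by
  have h1 : alphaMode k θ 0 = k * Real.sin θ := by simp [alphaMode]
  rw [betaMode, h1, if_pos]
  · congr 1
    rw [show k ^ 2 - (k * Real.sin θ) ^ 2 = (k * Real.cos θ) ^ 2 by
      rw [mul_pow, mul_pow, Real.cos_sq']; ring]
    exact Real.sqrt_sq (by positivity)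
  · rw [abs_mul, abs_of_pos hk]
    exact mul_le_of_le_one_right hk.le (Real.abs_sin_le_one θ)

/-- A downward plane wave is not a multiple of the upward one. -/
lemma eq_zero_of_standing_wave {β : ℝ} (hβ : 0 < β) {A E : ℂ} {h : ℝ}
    (hAE : ∀ y, h ≤ y → A * Complex.exp (-(Complex.I * (β : ℂ) * y)) +
      E * Complex.exp (Complex.I * (β : ℂ) * y) = 0) : A = 0 := by
  have e1 := hAE h le_rfl
  have e2 := hAE (h + Real.pi / 2 / β) (by
    have : 0 < Real.pi / 2 / β := by positivity
    linarith)
  have hβ' : (β : ℂ) ≠ 0 := by exact_mod_cast hβ.ne'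
  -- moving up by a quarter of a wave length multiplies the two waves by `-i` and by `i`
  have e3 : Complex.I * (β : ℂ) * ((h + Real.pi / 2 / β : ℝ) : ℂ) =
      Complex.I * (β : ℂ) * h + Real.pi / 2 * Complex.I := by
    push_cast
    field_simp
  rw [e3, neg_add, Complex.exp_add, Complex.exp_add, Complex.exp_neg (Real.pi / 2 * Complex.I),
    Complex.exp_pi_div_two_mul_I, Complex.inv_I] at e2
  have e4 : A * Complex.exp (-(Complex.I * (β : ℂ) * h)) = 0 := by
    linear_combination (1 / 2 : ℂ) * e1 + Complex.I / 2 * e2 -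
      (-A * Complex.exp (-(Complex.I * (β : ℂ) * h)) +
        E * Complex.exp (Complex.I * (β : ℂ) * h)) / 2 * Complex.I_sq
  exact (mul_eq_zero.1 e4).resolve_right (Complex.exp_ne_zero _)

/-- Total fields for two distinct incident directions are linearly independent above the grating:
only the first one contains the first incident wave. -/
theorem IsTotalField.coeff_eq_zero {θ₁ θ₂ : ℝ} (hk : 0 < k)
    (hθ₁ : 0 < Real.cos θ₁) (hθ : Real.sin θ₁ ≠ Real.sin θ₂)
    (h₁ : IsTotalField f η k θ₁ u₁) (h₂ : IsTotalField f η k θ₂ u₂) {b : ℝ} (hb : ∀ t, f t < b)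
    {A D : ℂ} (hAD : ∀ x : Plane, b ≤ x 1 → A * u₁ x + D * u₂ x = 0) : A = 0 := by
  obtain ⟨c, hc⟩ := h₁.exists_integral_eq
  obtain ⟨d, hd⟩ := h₂.exists_integral_eq
  have hpi : (2 * Real.pi : ℂ) ≠ 0 := by exact_mod_cast (by positivity : (2 * Real.pi) ≠ 0)
  have habove : ∀ y, b ≤ y → ∀ t, f t < y := fun y hy t => (hb t).trans_le hy
  have hint : ∀ {θ' : ℝ} {v : Plane → ℂ}, IsTotalField f η k θ' v → ∀ y, b ≤ y →
      Continuous fun t : ℝ => v !₂[t, y] := fun hv y hy =>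
    hv.contDiffOn.continuousOn.comp_continuous (continuous_vec continuous_id continuous_const)
      fun t => by simpa [upperDomain] using habove y hy t
  by_cases hj : ∃ j : ℤ, k * Real.sin θ₁ - k * Real.sin θ₂ = j
  · obtain ⟨j, hj⟩ := hj
    have hj0 : j ≠ 0 := by
      rintro rfl
      rw [Int.cast_zero, sub_eq_zero] at hj
      exact hθ (mul_left_cancel₀ hk.ne' hj)
    have hα : alphaMode k θ₁ 0 = alphaMode k θ₂ j := by
      simp only [alphaMode, ← hj]; simp
    have hβ : betaMode k θ₂ j = ((k * Real.cos θ₁ : ℝ) : ℂ) := by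
      rw [← betaMode_zero hk hθ₁, betaMode, betaMode, hα]
    refine eq_zero_of_standing_wave (β := k * Real.cos θ₁) (by positivity) (h := b)
      (E := A * c 0 + D * d j) fun y hy => ?_
    have e1 := hc y (habove y hy) θ₁ 0 0 rfl
    have e2 := hd y (habove y hy) θ₁ j 0 hα
    rw [if_pos rfl, betaMode_zero hk hθ₁] at e1
    rw [if_neg hj0, hβ, zero_mul, add_zero] at e2
    have c1 : Continuous fun t : ℝ => u₁ !₂[t, y] := hint h₁ y hy
    have c2 : Continuous fun t : ℝ => u₂ !₂[t, y] := hint h₂ y hy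
    have hexp : Continuous fun t : ℝ => Complex.exp (-(Complex.I * alphaMode k θ₁ 0 * t)) := by
      fun_prop
    have i1 : IntervalIntegrable (fun t : ℝ => A * (u₁ !₂[t, y] *
        Complex.exp (-(Complex.I * alphaMode k θ₁ 0 * t)))) volume 0 (2 * Real.pi) :=
      (continuous_const.mul (c1.mul hexp)).intervalIntegrable _ _
    have i2 : IntervalIntegrable (fun t : ℝ => D * (u₂ !₂[t, y] *
        Complex.exp (-(Complex.I * alphaMode k θ₁ 0 * t)))) volume 0 (2 * Real.pi) :=
      (continuous_const.mul (c2.mul hexp)).intervalIntegrable _ _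
    have e3 : A * (∫ t in (0 : ℝ)..2 * Real.pi,
        u₁ !₂[t, y] * Complex.exp (-(Complex.I * alphaMode k θ₁ 0 * t))) +
        D * ∫ t in (0 : ℝ)..2 * Real.pi,
        u₂ !₂[t, y] * Complex.exp (-(Complex.I * alphaMode k θ₁ 0 * t)) = 0 := by
      rw [← intervalIntegral.integral_const_mul, ← intervalIntegral.integral_const_mul,
        ← intervalIntegral.integral_add i1 i2]
      refine (intervalIntegral.integral_congr (g := fun _ => (0 : ℂ)) fun t _ => ?_).trans
        intervalIntegral.integral_zero
      have := hAD !₂[t, y] (by simpa using hy)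
      linear_combination Complex.exp (-(Complex.I * alphaMode k θ₁ 0 * t)) * this
    rw [e1, e2] at e3
    refine mul_left_cancel₀ hpi ?_
    linear_combination e3
  · -- different quasi-periodicities separate the two fields
    have hq : Complex.exp (2 * Complex.I * (k * Real.sin θ₁ : ℝ) * Real.pi) -
        Complex.exp (2 * Complex.I * (k * Real.sin θ₂ : ℝ) * Real.pi) ≠ 0 := by
      intro h
      obtain ⟨n, hn⟩ := Complex.exp_eq_exp_iff_exists_int.1 (sub_eq_zero.1 h)
      refine hj ⟨n, ?_⟩
      have h4 : ((k * Real.sin θ₁ - k * Real.sin θ₂ : ℝ) : ℂ) = ((n : ℝ) : ℂ) := by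
        push_cast at hn ⊢
        have h5 : (2 * Real.pi * Complex.I : ℂ) ≠ 0 := mul_ne_zero hpi Complex.I_ne_zero
        refine mul_left_cancel₀ h5 ?_
        linear_combination hn
      exact_mod_cast h4
    have hA : ∀ x : Plane, b ≤ x 1 → A * u₁ x = 0 := fun x hx => by
      have hxu : x ∈ upperDomain f := habove _ hx _
      have e1 := hAD x hx
      have e2 := hAD (x + !₂[2 * Real.pi, 0]) (by simpa using hx)
      rw [h₁.quasiperiodic x hxu, h₂.quasiperiodic x hxu] at e2
      refine mul_left_cancel₀ hq ?_
      linear_combination e2 - Complex.exp (2 * Complex.I * (k * Real.sin θ₂ : ℝ) * Real.pi) * e1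
    refine eq_zero_of_standing_wave (β := k * Real.cos θ₁) (by positivity) (h := b)
      (E := A * c 0) fun y hy => ?_
    have e1 := hc y (habove y hy) θ₁ 0 0 rfl
    rw [if_pos rfl, betaMode_zero hk hθ₁] at e1
    have e3 : A * (∫ t in (0 : ℝ)..2 * Real.pi,
        u₁ !₂[t, y] * Complex.exp (-(Complex.I * alphaMode k θ₁ 0 * t))) = 0 := by
      rw [← intervalIntegral.integral_const_mul]
      refine (intervalIntegral.integral_congr (g := fun _ => (0 : ℂ)) fun t _ => ?_).trans
        intervalIntegral.integral_zero
      have := hA !₂[t, y] (by simpa using hy)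
      linear_combination Complex.exp (-(Complex.I * alphaMode k θ₁ 0 * t)) * this
    rw [e1] at e3
    refine mul_left_cancel₀ hpi ?_
    linear_combination e3

end Rayleigh

/-! ### Polygonal gratings -/

section Grating

variable {f : ℝ → ℝ} {η : ℝ → OnePoint ℂ}

lemma isOpen_upperDomain (hf : Continuous f) : IsOpen (upperDomain f) := by
  refine isOpen_lt (hf.comp ?_) ?_ <;> fun_prop

lemma isPreconnected_upperDomain (hf : Continuous f) : IsPreconnected (upperDomain f) := by
  have h : upperDomain f = (fun q : ℝ × ℝ => (!₂[q.1, f q.1 + q.2] : Plane)) ''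
      (Set.univ ×ˢ Set.Ioi 0) := by
    ext x
    constructor
    · intro hx
      refine ⟨(x 0, x 1 - f (x 0)),
        ⟨Set.mem_univ _, Set.mem_Ioi.2 (sub_pos.2 (show f (x 0) < x 1 from hx))⟩, ?_⟩
      simp [plane_eta]
    · rintro ⟨q, ⟨-, hq⟩, rfl⟩
      simpa [upperDomain] using hq
  rw [h]
  refine (isPreconnected_univ.prod isPreconnected_Ioi).image _ (Continuous.continuousOn ?_)
  fun_prop

lemma upperDomain_inter (f g : ℝ → ℝ) :
    upperDomain f ∩ upperDomain g = upperDomain fun t => max (f t) (g t) := by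
  ext x; simp [upperDomain]

lemma IsAdmissible.continuous (h : IsAdmissible f η) : Continuous f := by
  obtain ⟨K, hK⟩ := h.lipschitz
  exact hK.continuous

lemma IsAdmissible.lt_of_lt (h : IsAdmissible f η) {b : ℝ}
    (hb : ∀ t ∈ Set.Icc 0 (2 * Real.pi), |f t| < b) (t : ℝ) : f t < b := by
  obtain ⟨s, hs, hst⟩ := h.periodic.exists_mem_Ico₀ (by positivity) t
  rw [hst]
  exact (le_abs_self _).trans_lt (hb s ⟨hs.1, hs.2.le⟩)

/-- A point `s` of `[t 0, t n)` has a right neighbourhood inside some cell `[t i, t (i + 1))`. -/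
lemma exists_cell_right {n : ℕ} {t : ℕ → ℝ} {s : ℝ} (h0 : t 0 ≤ s) (hn : s < t n) :
    ∃ i < n, t i ≤ s ∧ s < t (i + 1) := by
  induction n with
  | zero => exact absurd hn (not_lt.2 h0)
  | succ n ih =>
    rcases lt_or_ge s (t n) with h | h
    · obtain ⟨i, hi, hi'⟩ := ih h
      exact ⟨i, hi.trans (Nat.lt_succ_self n), hi'⟩
    · exact ⟨n, Nat.lt_succ_self n, h, hn⟩

/-- A point `s` of `(t 0, t n]` has a left neighbourhood inside some cell `(t i, t (i + 1)]`. -/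
lemma exists_cell_left {n : ℕ} {t : ℕ → ℝ} {s : ℝ} (h0 : t 0 < s) (hn : s ≤ t n) :
    ∃ i < n, t i < s ∧ s ≤ t (i + 1) := by
  induction n with
  | zero => exact absurd h0 (not_lt.2 hn)
  | succ n ih =>
    rcases le_or_gt s (t n) with h | h
    · obtain ⟨i, hi, hi'⟩ := ih h
      exact ⟨i, hi.trans (Nat.lt_succ_self n), hi'⟩
    · exact ⟨n, Nat.lt_succ_self n, h, hn⟩

/-- A linear piece translated by a multiple of the period. -/
lemma IsAdmissible.shift (h : IsAdmissible f η) {j : ℤ} {a b m c : ℝ} {e : OnePoint ℂ}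
    (hab : ∀ s ∈ Set.Ioo a b, f s = m * s + c ∧ η s = e) :
    ∀ s ∈ Set.Ioo (a + j * (2 * Real.pi)) (b + j * (2 * Real.pi)),
      f s = m * s + (c - m * (j * (2 * Real.pi))) ∧ η s = e := fun s hs => by
  have h1 := hab (s - j * (2 * Real.pi)) ⟨by linarith [hs.1], by linarith [hs.2]⟩
  rw [h.periodic.sub_int_mul_eq, h.periodic_parameter.sub_int_mul_eq] at h1
  exact ⟨by rw [h1.1]; ring, h1.2⟩

lemma IsAdmissible.exists_right (h : IsAdmissible f η) (t₀ : ℝ) :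
    ∃ (b m c : ℝ) (e : OnePoint ℂ), t₀ < b ∧ ∀ s ∈ Set.Ioo t₀ b, f s = m * s + c ∧ η s = e := by
  obtain ⟨n, t, h0, hn, -, hp⟩ := h.piecewise
  have h2π : 0 < 2 * Real.pi := by positivity
  set j := ⌊t₀ / (2 * Real.pi)⌋
  set s := t₀ - j * (2 * Real.pi) with hs
  have h1 : (j : ℝ) * (2 * Real.pi) ≤ t₀ := (le_div_iff₀ h2π).1 (Int.floor_le _)
  have h2 : t₀ < ((j : ℝ) + 1) * (2 * Real.pi) := (div_lt_iff₀ h2π).1 (Int.lt_floor_add_one _)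
  obtain ⟨i, hi, hi1, hi2⟩ := exists_cell_right (n := n) (t := t) (s := s)
    (by rw [h0]; linarith) (by rw [hn]; linarith)
  obtain ⟨m, c, e, hmc⟩ := hp i hi
  exact ⟨t (i + 1) + j * (2 * Real.pi), m, _, e, by linarith, fun x hx =>
    h.shift (j := j) hmc x ⟨by linarith [hx.1], hx.2⟩⟩

lemma IsAdmissible.exists_left (h : IsAdmissible f η) (t₀ : ℝ) :
    ∃ (a m c : ℝ) (e : OnePoint ℂ), a < t₀ ∧ ∀ s ∈ Set.Ioo a t₀, f s = m * s + c ∧ η s = e := by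
  obtain ⟨n, t, h0, hn, -, hp⟩ := h.piecewise
  have h2π : 0 < 2 * Real.pi := by positivity
  set j := ⌈t₀ / (2 * Real.pi)⌉ - 1 with hj
  set s := t₀ - j * (2 * Real.pi) with hs
  have h1 : (j : ℝ) * (2 * Real.pi) < t₀ := by
    rw [← lt_div_iff₀ h2π, hj]
    push_cast
    linarith [Int.ceil_lt_add_one (t₀ / (2 * Real.pi))]
  have h2 : t₀ ≤ ((j : ℝ) + 1) * (2 * Real.pi) := by
    rw [← div_le_iff₀ h2π, hj]
    push_cast
    linarith [Int.le_ceil (t₀ / (2 * Real.pi))]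
  obtain ⟨i, hi, hi1, hi2⟩ := exists_cell_left (n := n) (t := t) (s := s)
    (by rw [h0]; linarith) (by rw [hn]; linarith)
  obtain ⟨m, c, e, hmc⟩ := hp i hi
  exact ⟨t i + j * (2 * Real.pi), m, _, e, by linarith, fun x hx =>
    h.shift (j := j) hmc x ⟨hx.1, by linarith [hx.2]⟩⟩

/-- The line that contains a linear piece of a continuous curve passes through its end point, and
its slope is the one given by the germ of the curve at that end point. -/
lemma line_eq_of_germ {t₀ m c m' : ℝ} {l : Filter ℝ} [l.NeBot] (hf : Continuous f)
    (hl : l ≤ nhds t₀) (hne : ∀ᶠ s in l, s ≠ t₀) (h : ∀ᶠ s in l, f s = m * s + c)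
    (h' : ∀ᶠ s in l, f s = f t₀ + m' * (s - t₀)) : m = m' ∧ c = f t₀ - m * t₀ := by
  have h1 : f t₀ = m * t₀ + c := by
    have a1 : Tendsto f l (nhds (f t₀)) := hf.continuousAt.tendsto.mono_left hl
    have a2 : Tendsto (fun s => m * s + c) l (nhds (m * t₀ + c)) :=
      (Continuous.tendsto (by fun_prop) t₀).mono_left hl
    exact tendsto_nhds_unique a1 (a2.congr' (h.mono fun s hs => hs.symm))
  obtain ⟨s, h2, h3, h4⟩ := (hne.and (h.and h')).exists
  refine ⟨mul_right_cancel₀ (sub_ne_zero.2 h2) ?_, by linarith⟩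
  linarith

end Grating

/-! ### The two sides of a corner -/

section Corner

lemma PointwiseCondition.linearCombination {e : OnePoint ℂ} {m : ℝ} {v w : Plane → ℂ} {x : Plane}
    (hv : PointwiseCondition e m v x) (hw : PointwiseCondition e m w x)
    (hvd : DifferentiableAt ℝ v x) (hwd : DifferentiableAt ℝ w x) (c d : ℂ) :
    PointwiseCondition e m (c • v + d • w) x := by
  have h : ∀ i, partialDeriv i (c • v + d • w) x =
      c * partialDeriv i v x + d * partialDeriv i w x := fun i => by
    have h1 : fderiv ℝ (c • v + d • w) x = _ :=
      ((hvd.hasFDerivAt.const_smul c).add (hwd.hasFDerivAt.const_smul d)).fderiv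
    rw [partialDeriv, h1]
    simp [partialDeriv]
  refine ⟨fun he => ?_, fun he => ?_⟩
  · simp [hv.1 he, hw.1 he]
  · have h1 := hv.2 he
    have h2 := hw.2 he
    simp only [h, Pi.add_apply, Pi.smul_apply, smul_eq_mul]
    linear_combination c * h1 + d * h2

lemma cos_arctan_ne_zero (m : ℝ) : Real.cos (Real.arctan m) ≠ 0 := (Real.cos_arctan_pos m).ne'

lemma sin_arctan_eq (m : ℝ) : Real.sin (Real.arctan m) = m * Real.cos (Real.arctan m) := by
  have h := Real.tan_arctan m
  rw [Real.tan_eq_sin_div_cos, div_eq_iff (cos_arctan_ne_zero m)] at h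
  exact h

/-- The pointwise condition on a straight segment leaving `p`, in polar coordinates about `p`. The
sign `ς` is `1` for a segment to the right of `p` and `-1` for one to the left. -/
lemma hasRayCondition_of_pointwise {v : Plane → ℂ} {p : Plane} {φ m ς ε : ℝ} {e : OnePoint ℂ}
    (hε : 0 < ε) (hcos : Real.cos φ = ς * Real.cos (Real.arctan m))
    (hsin : Real.sin φ = ς * Real.sin (Real.arctan m))
    (h : ∀ τ ∈ Set.Ioo 0 ε, PointwiseCondition e m v (p + (ς * τ) • !₂[1, m])) :
    HasRayCondition v p φ := by
  have hc0 := Real.cos_arctan_pos m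
  set C := Real.cos (Real.arctan m)
  have hsin' : Real.sin φ = ς * (m * C) := by rw [hsin, sin_arctan_eq]
  have hdir : ∀ r : ℝ, p + r • polarDir φ = p + (ς * (r * C)) • !₂[1, m] := fun r => by
    congr 1
    ext i
    fin_cases i
    · simp [polarDir, hcos]; ring
    · simp [polarDir, hsin']; ring
  have hr : ∀ r ∈ Set.Ioo 0 (ε / C), r * C ∈ Set.Ioo 0 ε := fun r hr =>
    ⟨mul_pos hr.1 hc0, (lt_div_iff₀ hc0).1 hr.2⟩
  refine ⟨ε / C, by positivity, ?_⟩
  by_cases he : e = OnePoint.infty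
  · left
    intro r hr'
    rw [hdir]
    exact (h _ (hr r hr')).1 he
  · right
    refine ⟨-(ς * C * finiteValue e * (Real.sqrt (1 + m ^ 2) : ℂ)), fun r hr' => ?_⟩
    have h1 := (h _ (hr r hr')).2 he
    rw [← hdir] at h1
    rw [polarNormal_eq, map_add, map_smul, map_smul, hcos, hsin']
    simp only [partialDeriv] at h1
    simp only [Complex.real_smul]
    push_cast
    linear_combination (ς * C : ℂ) * h1

/-- The irrationality of the angle at a corner, in terms of the polar angles of its two sides. -/
lemma corner_angle_ne {m₁ m₂ : ℝ} (h : Irrational (cornerAngle m₁ m₂ / (2 * Real.pi))) (m : ℕ)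
    (hm : 0 < m) (j : ℤ) :
    4 * m * ((Real.arctan m₁ + Real.pi) - Real.arctan m₂) ≠ 2 * Real.pi * j := by
  intro hj
  set δ := (Real.arctan m₁ + Real.pi) - Real.arctan m₂ with hδ
  have hcos : Real.cos (cornerAngle m₁ m₂) = Real.cos δ := by
    rw [cornerAngle, InnerProductGeometry.cos_angle]
    have e1 : (!₂[-1, -m₁] : Plane) = (1 / Real.cos (Real.arctan m₁)) •
        polarDir (Real.arctan m₁ + Real.pi) := by
      have := cos_arctan_ne_zero m₁
      ext i
      fin_cases i
      · simp [polarDir, this]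
      · simp [polarDir, sin_arctan_eq]; field_simp
    have e2 : (!₂[1, m₂] : Plane) = (1 / Real.cos (Real.arctan m₂)) •
        polarDir (Real.arctan m₂) := by
      have := cos_arctan_ne_zero m₂
      ext i
      fin_cases i
      · simp [polarDir, this]
      · simp [polarDir, sin_arctan_eq]; field_simp
    have c1 := Real.cos_arctan_pos m₁
    have c2 := Real.cos_arctan_pos m₂
    rw [e1, e2, inner_smul_left, inner_smul_right, norm_smul, norm_smul, norm_polarDir,
      norm_polarDir, Real.norm_of_nonneg (by positivity), Real.norm_of_nonneg (by positivity),
      hδ, Real.cos_sub]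
    have e3 : inner ℝ (polarDir (Real.arctan m₁ + Real.pi)) (polarDir (Real.arctan m₂)) =
        Real.cos (Real.arctan m₁ + Real.pi) * Real.cos (Real.arctan m₂) +
        Real.sin (Real.arctan m₁ + Real.pi) * Real.sin (Real.arctan m₂) := by
      simp [polarDir, PiLp.inner_apply, Fin.sum_univ_two]
      ring
    rw [e3]
    simp only [conj_trivial]
    field_simp
  have hpi := Real.pi_pos
  have hm' : (m : ℝ) ≠ 0 := by exact_mod_cast hm.ne'
  have hrat : ∀ q : ℚ, cornerAngle m₁ m₂ ≠ q * (2 * Real.pi) := fun q hq => h ⟨q, by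
    rw [hq]; field_simp⟩
  have hδ' : δ = ((j : ℚ) / (4 * m) : ℚ) * (2 * Real.pi) := by
    push_cast
    field_simp
    linear_combination hj
  obtain ⟨n, hn⟩ := Real.cos_eq_cos_iff.1 hcos
  rcases hn with hn | hn
  · refine hrat ((j : ℚ) / (4 * m) - n) ?_
    push_cast at hδ' ⊢
    linear_combination hδ' - hn
  · refine hrat (n - (j : ℚ) / (4 * m)) ?_
    push_cast at hδ' ⊢
    linear_combination hn - hδ'

variable {f₁ f₂ : ℝ → ℝ} {η₁ η₂ : ℝ → OnePoint ℂ} {k : ℝ} {p : Plane} {R : ℝ}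

/-- The boundary condition on a linear piece that leaves `p`, for linear combinations of total
fields that extend across the curve near `p`. -/
lemma pointwiseCondition_of_isTotalField (hf : Continuous f₁) (hR : 0 < R)
    (hp : p 1 = f₁ (p 0)) {θ : Fin 2 → ℝ} {u v : Fin 2 → Plane → ℂ}
    (hu : ∀ l, IsTotalField f₁ η₁ k (θ l) (u l))
    (hv : ∀ l, SolvesHelmholtz k (v l) (Metric.ball p R))
    (huv : ∀ l, ∀ x ∈ upperDomain f₁ ∩ Metric.ball p R, u l x = v l x) {a b m : ℝ}
    {e : OnePoint ℂ} (hline : ∀ t ∈ Set.Ioo a b, f₁ t = m * t + (f₁ (p 0) - m * p 0) ∧ η₁ t = e)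
    (hsmall : ∀ t ∈ Set.Ioo a b, |t - p 0| * ‖(!₂[1, m] : Plane)‖ < R / 2) (c d : ℂ) :
    ∀ t ∈ Set.Ioo a b,
      PointwiseCondition e m (c • v 0 + d • v 1) (p + (t - p 0) • !₂[1, m]) := by
  have hpt : ∀ t : ℝ, (!₂[t, m * t + (f₁ (p 0) - m * p 0)] : Plane) =
      p + (t - p 0) • !₂[1, m] := fun t => by
    ext i
    fin_cases i
    · simp
    · simp [hp]; ring
  have hball : ∀ t ∈ Set.Ioo a b,
      !₂[t, m * t + (f₁ (p 0) - m * p 0)] ∈ Metric.ball p (R / 2) := fun t ht => by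
    rw [hpt, Metric.mem_ball, dist_self_add_left, norm_smul]
    exact hsmall t ht
  have hcond : ∀ l, ∀ t ∈ Set.Ioo a b,
      PointwiseCondition e m (v l) (p + (t - p 0) • !₂[1, m]) := fun l t ht => by
    obtain ⟨w, hw, hbc⟩ := (hu l).boundary
    rw [← hpt]
    exact hbc.pointwise hf (hu l).contDiffOn.continuousOn hw hR (hv l) (isOpen_upperDomain hf)
      (huv l) hline hball t ht
  intro t ht
  have hmem : p + (t - p 0) • !₂[1, m] ∈ Metric.ball p R := by
    rw [← hpt]
    exact Metric.ball_subset_ball (by linarith) (hball t ht)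
  have hdiff : ∀ l, DifferentiableAt ℝ (v l) (p + (t - p 0) • !₂[1, m]) := fun l =>
    (hasFDerivAt_of_contDiffOn Metric.isOpen_ball (hv l).1 hmem).differentiableAt
  exact (hcond 0 t ht).linearCombination (hcond 1 t ht) (hdiff 0) (hdiff 1) c d

/-- At a corner across which the total fields extend, every linear combination of the extensions
satisfies boundary conditions on both sides. -/
lemma hasRayCondition_of_isTotalField (h₁ : IsAdmissible f₁ η₁) (hR : 0 < R)
    (hp : p 1 = f₁ (p 0)) {θ : Fin 2 → ℝ} {u v : Fin 2 → Plane → ℂ}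
    (hu : ∀ l, IsTotalField f₁ η₁ k (θ l) (u l))
    (hv : ∀ l, SolvesHelmholtz k (v l) (Metric.ball p R))
    (huv : ∀ l, ∀ x ∈ upperDomain f₁ ∩ Metric.ball p R, u l x = v l x) {m₁ m₂ : ℝ}
    (hcorner : HasCornerAt f₁ (p 0) m₁ m₂) (c d : ℂ) :
    HasRayCondition (c • v 0 + d • v 1) p (Real.arctan m₁ + Real.pi) ∧
      HasRayCondition (c • v 0 + d • v 1) p (Real.arctan m₂) := by
  have hf := h₁.continuous
  have hpos : ∀ m : ℝ, 0 < R / 2 / (‖(!₂[1, m] : Plane)‖ + 1) := fun m => by positivity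
  have hsmall : ∀ m x : ℝ, |x| < R / 2 / (‖(!₂[1, m] : Plane)‖ + 1) →
      |x| * ‖(!₂[1, m] : Plane)‖ < R / 2 := fun m x hx => by
    rw [lt_div_iff₀ (by positivity)] at hx
    nlinarith [abs_nonneg x]
  constructor
  · obtain ⟨a, m, c₀, e, ha, hline⟩ := h₁.exists_left (p 0)
    obtain ⟨rfl, rfl⟩ := line_eq_of_germ (l := nhdsWithin (p 0) (Set.Iio (p 0))) hf
      nhdsWithin_le_nhds
      (eventually_nhdsWithin_of_forall fun s hs => ne_of_lt hs)
      (by filter_upwards [Ioo_mem_nhdsLT ha] with s hs using (hline s hs).1) hcorner.2.1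
    set ε := min (p 0 - a) (R / 2 / (‖(!₂[1, m] : Plane)‖ + 1))
    have hε0 : 0 < ε := lt_min (by linarith) (hpos m)
    have hε1 : ε ≤ p 0 - a := min_le_left _ _
    have hε2 : ε ≤ R / 2 / (‖(!₂[1, m] : Plane)‖ + 1) := min_le_right _ _
    refine hasRayCondition_of_pointwise (ς := -1) (m := m) (e := e) hε0 (by simp) (by simp)
      fun τ hτ => ?_
    have h := pointwiseCondition_of_isTotalField hf hR hp hu hv huv (a := p 0 - ε) (b := p 0)
      (m := m) (e := e)
      (fun t ht => hline t ⟨by linarith [ht.1], ht.2⟩)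
      (fun t ht => hsmall m _ (by
        rw [abs_of_neg (by linarith [ht.2])]
        linarith [ht.1])) c d
      (p 0 - τ) ⟨by linarith [hτ.2], by linarith [hτ.1]⟩
    rwa [show p 0 - τ - p 0 = -1 * τ by ring] at h
  · obtain ⟨b, m, c₀, e, hb, hline⟩ := h₁.exists_right (p 0)
    obtain ⟨rfl, rfl⟩ := line_eq_of_germ (l := nhdsWithin (p 0) (Set.Ioi (p 0))) hf
      nhdsWithin_le_nhds
      (eventually_nhdsWithin_of_forall fun s hs => ne_of_gt hs)
      (by filter_upwards [Ioo_mem_nhdsGT hb] with s hs using (hline s hs).1) hcorner.2.2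
    set ε := min (b - p 0) (R / 2 / (‖(!₂[1, m] : Plane)‖ + 1))
    have hε0 : 0 < ε := lt_min (by linarith) (hpos m)
    have hε1 : ε ≤ b - p 0 := min_le_left _ _
    have hε2 : ε ≤ R / 2 / (‖(!₂[1, m] : Plane)‖ + 1) := min_le_right _ _
    refine hasRayCondition_of_pointwise (ς := 1) (m := m) (e := e) hε0 (by simp) (by simp)
      fun τ hτ => ?_
    have h := pointwiseCondition_of_isTotalField hf hR hp hu hv huv (a := p 0) (b := p 0 + ε)
      (m := m) (e := e)
      (fun t ht => hline t ⟨ht.1, by linarith [ht.2]⟩)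
      (fun t ht => hsmall m _ (by
        rw [abs_of_pos (by linarith [ht.1])]
        linarith [ht.2])) c d
      (p 0 + τ) ⟨by linarith [hτ.1], by linarith [hτ.2]⟩
    rwa [show p 0 + τ - p 0 = 1 * τ by ring] at h

/-- Total fields for two gratings that agree on a horizontal line above both agree above both
gratings. -/
lemma IsTotalField.eq_of_measurement {θ b : ℝ} {u₁ u₂ : Plane → ℂ}
    (hf₁ : Continuous f₁) (hf₂ : Continuous f₂) (h₁ : IsTotalField f₁ η₁ k θ u₁)
    (h₂ : IsTotalField f₂ η₂ k θ u₂) (hb₁ : ∀ t, f₁ t < b) (hb₂ : ∀ t, f₂ t < b)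
    (hmeas : ∀ t ∈ Set.Icc 0 (2 * Real.pi), u₁ !₂[t, b] = u₂ !₂[t, b]) :
    ∀ x ∈ upperDomain f₁ ∩ upperDomain f₂, u₁ x = u₂ x := by
  have hopen := (isOpen_upperDomain hf₁).inter (isOpen_upperDomain hf₂)
  have hconn : IsPreconnected (upperDomain f₁ ∩ upperDomain f₂) := by
    rw [upperDomain_inter]
    exact isPreconnected_upperDomain (hf₁.max hf₂)
  have e₁ : SolvesHelmholtz k u₁ (upperDomain f₁ ∩ upperDomain f₂) :=
    SolvesHelmholtz.mono ⟨h₁.contDiffOn, h₁.helmholtz⟩ Set.inter_subset_left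
  have e₂ : SolvesHelmholtz k u₂ (upperDomain f₁ ∩ upperDomain f₂) :=
    SolvesHelmholtz.mono ⟨h₂.contDiffOn, h₂.helmholtz⟩ Set.inter_subset_right
  have hq : (!₂[0, b + 1] : Plane) ∈ upperDomain f₁ ∩ upperDomain f₂ := by
    have a₁ := hb₁ 0
    have a₂ := hb₂ 0
    constructor
    · simp only [upperDomain, Set.mem_ofPred_eq]; simp; linarith
    · simp only [upperDomain, Set.mem_ofPred_eq]; simp; linarith
  have hnear : ∀ᶠ x in nhds (!₂[0, b + 1] : Plane), ((1 : ℂ) • u₁ + (-1 : ℂ) • u₂) x = 0 := by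
    have ho : IsOpen {x : Plane | b < x 1} := isOpen_lt continuous_const (by fun_prop)
    filter_upwards [ho.mem_nhds (show (!₂[0, b + 1] : Plane) ∈ {x : Plane | b < x 1} by simp)]
      with x hx
    simp [h₁.eq_above h₂ hb₁ hb₂ hmeas (le_of_lt hx)]
  intro x hx
  have h := (e₁.linearCombination hopen e₂ 1 (-1)).eq_zero_of_isPreconnected hopen hconn hq hnear
    x hx
  simpa [add_neg_eq_zero] using h

/-- A corner of one grating is not visible in the domain above the other one. -/
theorem not_corner_of_measurements (h₁ : IsAdmissible f₁ η₁) (h₁' : AllCornersIrrational f₁)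
    (h₂ : IsAdmissible f₂ η₂) (hk : 0 < k) {θ : Fin 2 → ℝ}
    (hθ : ∀ l, 0 < Real.cos (θ l)) (hsin : Real.sin (θ 0) ≠ Real.sin (θ 1))
    {u₁ u₂ : Fin 2 → Plane → ℂ} (hu₁ : ∀ l, IsTotalField f₁ η₁ k (θ l) (u₁ l))
    (hu₂ : ∀ l, IsTotalField f₂ η₂ k (θ l) (u₂ l)) {b : ℝ} (hb₁ : ∀ t, f₁ t < b)
    (hb₂ : ∀ t, f₂ t < b)
    (hmeas : ∀ l, ∀ t ∈ Set.Icc 0 (2 * Real.pi), u₁ l !₂[t, b] = u₂ l !₂[t, b])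
    (hcorner : p ∈ cornerPoints f₁) (hp : p ∈ closure (upperDomain f₂)) :
    p ∈ profileCurve f₂ := by
  by_contra hp₂
  have hf₁ := h₁.continuous
  have hf₂ := h₂.continuous
  obtain ⟨hp₁, m₁, m₂, hc⟩ := hcorner
  have hpU : p ∈ upperDomain f₂ := by
    have h : IsClosed {x : Plane | f₂ (x 0) ≤ x 1} := by
      refine isClosed_le (hf₂.comp ?_) ?_ <;> fun_prop
    have hsub : upperDomain f₂ ⊆ {x : Plane | f₂ (x 0) ≤ x 1} :=
      fun x hx => show f₂ (x 0) ≤ x 1 from le_of_lt hx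
    have h' : p ∈ {x : Plane | f₂ (x 0) ≤ x 1} := closure_minimal hsub h hp
    exact lt_of_le_of_ne h' fun h0 => hp₂ h0.symm
  have hopen := isOpen_upperDomain hf₂
  obtain ⟨R, hR, hRU⟩ := Metric.isOpen_iff.1 hopen p hpU
  have hsol : ∀ l, SolvesHelmholtz k (u₂ l) (upperDomain f₂) := fun l =>
    ⟨(hu₂ l).contDiffOn, (hu₂ l).helmholtz⟩
  have huv : ∀ l, ∀ x ∈ upperDomain f₁ ∩ Metric.ball p R, u₁ l x = u₂ l x := fun l x hx =>
    (hu₁ l).eq_of_measurement hf₁ hf₂ (hu₂ l) hb₁ hb₂ (hmeas l) x ⟨hx.1, hRU hx.2⟩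
  -- only the trivial linear combination of the two fields vanishes at the corner
  have key : ∀ c d : ℂ, (c • u₂ 0 + d • u₂ 1) p = 0 → c = 0 ∧ d = 0 := fun c d h0 => by
    have hcomb := (hsol 0).linearCombination hopen (hsol 1) c d
    obtain ⟨r₁, r₂⟩ := hasRayCondition_of_isTotalField h₁ hR hp₁ hu₁
      (fun l => (hsol l).mono hRU) huv hc c d
    have hnear := (hcomb.mono hRU).eq_zero_near_corner hR h0
      (fun m hm j => corner_angle_ne (h₁' _ _ _ hc) m hm j) r₁ r₂
    have hzero := hcomb.eq_zero_of_isPreconnected hopen (isPreconnected_upperDomain hf₂) hpU hnear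
    have habove : ∀ x : Plane, b ≤ x 1 → c * u₂ 0 x + d * u₂ 1 x = 0 := fun x hx =>
      hzero x ((hb₂ _).trans_le hx)
    exact ⟨IsTotalField.coeff_eq_zero hk (hθ 0) hsin (hu₂ 0) (hu₂ 1) hb₂ habove,
      IsTotalField.coeff_eq_zero hk (hθ 1) hsin.symm (hu₂ 1) (hu₂ 0) hb₂
        fun x hx => by rw [add_comm]; exact habove x hx⟩
  -- applied to a combination that vanishes at `p` by construction, this makes both fields vanish at
  -- `p`, and then the combination that consists of the first field alone is a contradiction
  obtain ⟨-, h0⟩ := key (u₂ 1 p) (-u₂ 0 p) (by simp; ring)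
  exact one_ne_zero (key 1 0 (by simpa using h0)).1

end Corner

end DiffractionGrating

theorem theorem8p5
    (f₁ f₂ : ℝ → ℝ) (η₁ η₂ : ℝ → OnePoint ℂ)
    (hf₁ : DiffractionGrating.IsAdmissible f₁ η₁)
    (hf₁_irr : DiffractionGrating.AllCornersIrrational f₁)
    (hf₂ : DiffractionGrating.IsAdmissible f₂ η₂)
    (hf₂_irr : DiffractionGrating.AllCornersIrrational f₂)
    (G : Set DiffractionGrating.Plane)
    (hG : DiffractionGrating.IsUnboundedComponent G
      (DiffractionGrating.upperDomain f₁ ∩ DiffractionGrating.upperDomain f₂))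
    (k : ℝ) (hk : 0 < k)
    (θ : Fin 2 → ℝ) (hθ : ∀ l, θ l ∈ Set.Ioo (-(Real.pi / 2)) (Real.pi / 2))
    (hd : DiffractionGrating.incidentDirection (θ 0) ≠ DiffractionGrating.incidentDirection (θ 1))
    (u₁ u₂ : Fin 2 → DiffractionGrating.Plane → ℂ)
    (hu₁ : ∀ l, DiffractionGrating.IsTotalField f₁ η₁ k (θ l) (u₁ l))
    (hu₂ : ∀ l, DiffractionGrating.IsTotalField f₂ η₂ k (θ l) (u₂ l))
    (b : ℝ) (hb₁ : ∀ t ∈ Set.Icc 0 (2 * Real.pi), |f₁ t| < b)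
    (hb₂ : ∀ t ∈ Set.Icc 0 (2 * Real.pi), |f₂ t| < b)
    (hmeas : ∀ l, ∀ x₁ ∈ Set.Icc 0 (2 * Real.pi), u₁ l !₂[x₁, b] = u₂ l !₂[x₁, b]) :
    (¬ ∃ p ∈ DiffractionGrating.cornerPoints f₁,
        p ∈ frontier G \ DiffractionGrating.profileCurve f₂) ∧
    (¬ ∃ p ∈ DiffractionGrating.cornerPoints f₂,
        p ∈ frontier G \ DiffractionGrating.profileCurve f₁) := by
  have hcos : ∀ l, 0 < Real.cos (θ l) := fun l => Real.cos_pos_of_mem_Ioo (hθ l)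
  have hsin : Real.sin (θ 0) ≠ Real.sin (θ 1) := fun h => hd <| by
    rw [Real.injOn_sin ⟨(hθ 0).1.le, (hθ 0).2.le⟩ ⟨(hθ 1).1.le, (hθ 1).2.le⟩ h]
  have hb₁' := hf₁.lt_of_lt hb₁
  have hb₂' := hf₂.lt_of_lt hb₂
  obtain ⟨⟨x, -, rfl⟩, -⟩ := hG
  have hsub := connectedComponentIn_subset
    (DiffractionGrating.upperDomain f₁ ∩ DiffractionGrating.upperDomain f₂) x
  constructor
  · rintro ⟨p, hp, hpG, hp'⟩
    exact hp' (DiffractionGrating.not_corner_of_measurements hf₁ hf₁_irr hf₂ hk hcos hsin hu₁ hu₂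
      hb₁' hb₂' hmeas hp
      (closure_mono (hsub.trans Set.inter_subset_right) (frontier_subset_closure hpG)))
  · rintro ⟨p, hp, hpG, hp'⟩
    exact hp' (DiffractionGrating.not_corner_of_measurements hf₂ hf₂_irr hf₁ hk hcos hsin hu₂ hu₁
      hb₂' hb₁' (fun l t ht => (hmeas l t ht).symm) hp
      (closure_mono (hsub.trans Set.inter_subset_left) (frontier_subset_closure hpG)))
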